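/- Let $n,m\ge 0$ be integers, let $Y$ be a normed space, let $f\colon\mathbb R^n\times\mathbb R^m\to\mathbb R^n$ be Lipschitz in the first variable on bounded sets, i.e. for every $r>0$ there is $L(r)>0$ with $\|f(x_1,v)-f(x_2,v)\|\le L(r)\|x_1-x_2\|$ whenever $\|x_1\|,\|x_2\|,\|v\|<r$, and let $h\colon\mathbb R^n\to Y$ be continuous with $h(0)=0$. Let $\mathcal U=L^\infty([0,\infty),\mathbb R^m)$ be the space of essentially bounded Lebesgue measurable inputs, with norm $\|u\|_{\mathcal U}=\operatorname{ess\,sup}_{t\ge0}\|u(t)\|$. Consider the system $$\dot x=f(x,u),\qquad y=h(x),$$ and assume that it is forward complete: for all $x\in\mathbb R^n$ and $u\in\mathcal U$ there is a (necessarily unique) Carathéodory solution $\phi(\cdot,x,u)$ on $[0,\infty)$, i.e. a continuous function such that $s\mapsto f(\phi(s,x,u),u(s))$ is integrable on $[0,t]$ and $\phi(t,x,u)=x+\int_0^t f(\phi(s,x,u),u(s))\,ds$ for all $t\ge0$. Put $y(t,x,u)=h(\phi(t,x,u))$. Let $\mathcal K$ be the set of continuous strictly increasing $\gamma\colon[0,\infty)\to[0,\infty)$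 with $\gamma(0)=0$, let $\mathcal K_\infty$ be the set of unbounded elements of $\mathcal K$, and let $\mathcal{KL}$ be the set of $\beta\colon[0,\infty)^2\to[0,\infty)$ such that $\beta(\cdot,t)\in\mathcal K$ for all $t\ge0$ and, for all $r>0$, $\beta(r,\cdot)$ is continuous and decreasing with limit $0$ at infinity. The system is called - OLIM if there is $\gamma\in\mathcal K_\infty$ such that for all $\varepsilon>0$, $x\in\mathbb R^n$, $u\in\mathcal U$ there is $t\ge0$ with $\|y(t,x,u)\|\le\varepsilon+\gamma(\|u\|_{\mathcal U})$; - OL if there are $\sigma,\gamma\in\mathcal K_\infty$ with $\|y(t,x,u)\|\le\sigma(\|y(0,x,u)\|)+\gamma(\|u\|_{\mathcal U})$ for all $t\ge 0$, $x\in\mathbb R^n$, $u\in\mathcal U$; - OGUAG if there is $\gamma\in\mathcal K_\infty$ such that for all $\varepsilon,r>0$ there is $\tau\ge0$ with $\|y(t,x,u)\|\le\varepsilon+\gamma(\|u\|_{\mathcal U})$ for all $\|x\|<r$, $u\in\mathcal U$, $t\ge\tau$; - OUAG if there is $\gamma\in\mathcal K_\infty$ such that for all $\varepsilon,r,s>0$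 there is $\tau\ge0$ with $\|y(t,x,u)\|\le\varepsilon+\gamma(\|u\|_{\mathcal U})$ for all $\|x\|<r$, $\|u\|_{\mathcal U}<s$, $t\ge\tau$; - IOS if there are $\beta\in\mathcal{KL}$, $\gamma\in\mathcal K_\infty$ with $\|y(t,x,u)\|\le\beta(\|x\|,t)+\gamma(\|u\|_{\mathcal U})$ for all $t\ge 0$, $x\in\mathbb R^n$, $u\in\mathcal U$. Then: 1. the system is OLIM and OL if and only if it is OGUAG and OL; 2. if $f(0,0)=0$, then the system is OUAG if and only if it is IOS. -/

import Mathlib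

open MeasureTheory Set
open scoped NNReal ENNReal

/-! ### Comparison functions -/

/-- Class `𝒦`: continuous, strictly increasing functions `ℝ≥0 → ℝ≥0` vanishing at `0`. -/
def IsClassK (γ : ℝ≥0 → ℝ≥0) : Prop :=
  γ 0 = 0 ∧ Continuous γ ∧ StrictMono γ

/-- Class `𝒦∞`: unbounded functions of class `𝒦`. -/
def IsClassKInf (γ : ℝ≥0 → ℝ≥0) : Prop :=
  IsClassK γ ∧ ¬ BddAbove (range γ)

/-- Class `ℒ`: continuous, decreasing functions `ℝ≥0 → ℝ≥0` with limit `0` at infinity. -/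
def IsClassL (γ : ℝ≥0 → ℝ≥0) : Prop :=
  Continuous γ ∧ Antitone γ ∧ Filter.Tendsto γ Filter.atTop (nhds 0)

/-- Class `𝒦ℒ`. -/
def IsClassKL (β : ℝ≥0 → ℝ≥0 → ℝ≥0) : Prop :=
  (∀ t, IsClassK fun r => β r t) ∧ ∀ r, 0 < r → IsClassL fun t => β r t

/-! ### Stability notions for an output trajectory map `y : (t, x, u) ↦ y(t, x, u)` -/

section Notions

variable {X 𝒰 Y : Type*} [NormedAddCommGroup X] [NormedAddCommGroup 𝒰] [NormedAddCommGroup Y]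

/-- Input-to-output stability. -/
def IsIOS (y : ℝ≥0 → X → 𝒰 → Y) : Prop :=
  ∃ β γ, IsClassKL β ∧ IsClassKInf γ ∧
    ∀ (x : X) (u : 𝒰) (t : ℝ≥0), ‖y t x u‖₊ ≤ β ‖x‖₊ t + γ ‖u‖₊

/-- Output Lagrange stability. -/
def IsOL (y : ℝ≥0 → X → 𝒰 → Y) : Prop :=
  ∃ σ γ, IsClassKInf σ ∧ IsClassKInf γ ∧
    ∀ (x : X) (u : 𝒰) (t : ℝ≥0), ‖y t x u‖₊ ≤ σ ‖y 0 x u‖₊ + γ ‖u‖₊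

/-- Output-global uniform asymptotic gain property. -/
def IsOGUAG (y : ℝ≥0 → X → 𝒰 → Y) : Prop :=
  ∃ γ, IsClassKInf γ ∧ ∀ ε r : ℝ≥0, 0 < ε → 0 < r → ∃ τ : ℝ≥0,
    ∀ (x : X) (u : 𝒰) (t : ℝ≥0), ‖x‖₊ < r → τ ≤ t → ‖y t x u‖₊ ≤ ε + γ ‖u‖₊

/-- Output-uniform asymptotic gain property. -/
def IsOUAG (y : ℝ≥0 → X → 𝒰 → Y) : Prop :=
  ∃ γ, IsClassKInf γ ∧ ∀ ε r s : ℝ≥0, 0 < ε → 0 < r → 0 < s → ∃ τ : ℝ≥0,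
    ∀ (x : X) (u : 𝒰) (t : ℝ≥0), ‖x‖₊ < r → ‖u‖₊ < s → τ ≤ t →
      ‖y t x u‖₊ ≤ ε + γ ‖u‖₊

/-- Output-limit property. -/
def IsOLIM (y : ℝ≥0 → X → 𝒰 → Y) : Prop :=
  ∃ γ, IsClassKInf γ ∧ ∀ ε : ℝ≥0, 0 < ε → ∀ (x : X) (u : 𝒰), ∃ t : ℝ≥0,
    ‖y t x u‖₊ ≤ ε + γ ‖u‖₊

end Notions

/-! ### ODE systems `ẋ = f(x, u)`, `y = h(x)` -/

/-- Essentially bounded Lebesgue measurable inputs on `[0, ∞)` with values in `ℝᵐ`, normed by the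
essential supremum. -/
abbrev InputSpace (m : ℕ) : Type :=
  Lp (EuclideanSpace ℝ (Fin m)) ∞ (volume.restrict (Ici (0 : ℝ)))

section ODE

variable {n m : ℕ}

/-- `f` is Lipschitz in the first variable on bounded subsets. -/
def LipschitzFstOnBounded
    (f : EuclideanSpace ℝ (Fin n) → EuclideanSpace ℝ (Fin m) → EuclideanSpace ℝ (Fin n)) : Prop :=
  ∀ r : ℝ, 0 < r → ∃ L : ℝ, 0 < L ∧
    ∀ x₁ x₂ : EuclideanSpace ℝ (Fin n), ∀ v : EuclideanSpace ℝ (Fin m),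
      ‖x₁‖ < r → ‖x₂‖ < r → ‖v‖ < r → ‖f x₁ v - f x₂ v‖ ≤ L * ‖x₁ - x₂‖

/-- `ξ` is a (Carathéodory) solution on all of `[0, ∞)` of `ẋ = f(x, u)`, `x(0) = x₀`; it is
written in integral form, i.e. `ξ` is locally absolutely continuous and satisfies the equation
almost everywhere. -/
def IsTrajectory
    (f : EuclideanSpace ℝ (Fin n) → EuclideanSpace ℝ (Fin m) → EuclideanSpace ℝ (Fin n))
    (x₀ : EuclideanSpace ℝ (Fin n)) (u : InputSpace m) (ξ : ℝ → EuclideanSpace ℝ (Fin n)) : Prop :=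
  ContinuousOn ξ (Ici 0) ∧
    ∀ t : ℝ, 0 ≤ t → IntervalIntegrable (fun s => f (ξ s) (u s)) volume 0 t ∧
      ξ t = x₀ + ∫ s in (0 : ℝ)..t, f (ξ s) (u s)

/-- Forward completeness: for all initial states and inputs the solution exists on `[0, ∞)`. -/
def ForwardComplete
    (f : EuclideanSpace ℝ (Fin n) → EuclideanSpace ℝ (Fin m) → EuclideanSpace ℝ (Fin n)) : Prop :=
  ∀ (x₀ : EuclideanSpace ℝ (Fin n)) (u : InputSpace m), ∃ ξ, IsTrajectory f x₀ u ξ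

/-- The transition map `φ(t, x₀, u)` of a forward complete ODE system. The chosen solution is the
only one when `f` is Lipschitz in the first variable on bounded subsets, see
`IsTrajectory.eq_transitionMap`. -/
noncomputable def transitionMap
    (f : EuclideanSpace ℝ (Fin n) → EuclideanSpace ℝ (Fin m) → EuclideanSpace ℝ (Fin n))
    (t : ℝ≥0) (x₀ : EuclideanSpace ℝ (Fin n)) (u : InputSpace m) : EuclideanSpace ℝ (Fin n) :=
  Classical.epsilon (IsTrajectory f x₀ u) t

/-- The output `y(t, x₀, u) = h(φ(t, x₀, u))`. -/
noncomputable def odeOutput {Y : Type*}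
    (f : EuclideanSpace ℝ (Fin n) → EuclideanSpace ℝ (Fin m) → EuclideanSpace ℝ (Fin n))
    (h : EuclideanSpace ℝ (Fin n) → Y)
    (t : ℝ≥0) (x₀ : EuclideanSpace ℝ (Fin n)) (u : InputSpace m) : Y :=
  h (transitionMap f t x₀ u)

theorem IsTrajectory.eqOn
    {f : EuclideanSpace ℝ (Fin n) → EuclideanSpace ℝ (Fin m) → EuclideanSpace ℝ (Fin n)}
    (hf : LipschitzFstOnBounded f) {x₀ : EuclideanSpace ℝ (Fin n)} {u : InputSpace m}
    {ξ η : ℝ → EuclideanSpace ℝ (Fin n)} (hξ : IsTrajectory f x₀ u ξ)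
    (hη : IsTrajectory f x₀ u η) : EqOn ξ η (Ici 0) := by
  intro T hT
  have hT : (0 : ℝ) ≤ T := hT
  have hcξ : ContinuousOn ξ (Icc 0 T) := hξ.1.mono Icc_subset_Ici_self
  have hcη : ContinuousOn η (Icc 0 T) := hη.1.mono Icc_subset_Ici_self
  obtain ⟨A, hA⟩ := isCompact_Icc.exists_bound_of_continuousOn hcξ
  obtain ⟨B, hB⟩ := isCompact_Icc.exists_bound_of_continuousOn hcη
  set r : ℝ := |A| + |B| + ‖u‖ + 1 with hr
  have hr0 : 0 < r := by positivity
  obtain ⟨L, hL, hLip⟩ := hf r hr0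
  set D : ℝ → ℝ := fun t => ‖ξ t - η t‖ with hD
  have hDc : ContinuousOn D (Icc 0 T) := (hcξ.sub hcη).norm
  -- bound on the input
  have hu : ∀ᵐ s ∂(volume.restrict (Ici (0 : ℝ))), ‖u s‖ < r := by
    have := ae_le_eLpNormEssSup (f := (u : ℝ → EuclideanSpace ℝ (Fin m)))
      (μ := volume.restrict (Ici (0 : ℝ)))
    filter_upwards [this] with s hs
    have h1 : ‖u s‖ ≤ ‖u‖ := by
      rw [Lp.norm_def, eLpNorm_exponent_top, ← toReal_enorm]
      refine ENNReal.toReal_mono ?_ hs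
      have := Lp.eLpNorm_ne_top u
      rwa [eLpNorm_exponent_top] at this
    have := abs_nonneg A
    have := abs_nonneg B
    linarith
  have key : ∀ t ∈ Icc (0 : ℝ) T, D t ≤ L * ∫ s in (0 : ℝ)..t, D s := by
    intro t ht
    have e1 := (hξ.2 t ht.1).2
    have e2 := (hη.2 t ht.1).2
    have hsub : ξ t - η t = ∫ s in (0 : ℝ)..t, (f (ξ s) (u s) - f (η s) (u s)) := by
      rw [intervalIntegral.integral_sub (hξ.2 t ht.1).1 (hη.2 t ht.1).1, e1, e2]
      abel
    have hDi : IntervalIntegrable D volume 0 t :=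
      (hDc.mono (by rw [uIcc_of_le ht.1]; exact Icc_subset_Icc_right ht.2)).intervalIntegrable
    simp only [hD]
    rw [hsub, ← intervalIntegral.integral_const_mul]
    refine intervalIntegral.norm_integral_le_of_norm_le ht.1 ?_ (hDi.const_mul L)
    have hu' := (ae_restrict_iff' measurableSet_Ici).1 hu
    filter_upwards [hu'] with s hs hst
    have hs0 : s ∈ Icc (0 : ℝ) T := ⟨hst.1.le, hst.2.trans ht.2⟩
    refine hLip _ _ _ ?_ ?_ (hs hs0.1)
    · have := hA s hs0
      have := le_abs_self A
      have := abs_nonneg B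
      have := norm_nonneg u
      linarith
    · have := hB s hs0
      have := le_abs_self B
      have := abs_nonneg A
      have := norm_nonneg u
      linarith
  -- a continuous extension of `D`, and Gronwall for its primitive
  set E : ℝ → ℝ := IccExtend hT ((Icc 0 T).domRestrict D) with hE
  have hEc : Continuous E := (continuousOn_iff_continuous_domRestrict.1 hDc).Icc_extend'
  have hED : ∀ t ∈ Icc (0 : ℝ) T, E t = D t := fun t ht => by
    rw [hE, IccExtend_of_mem hT _ ht]; rfl
  set G : ℝ → ℝ := fun t => ∫ s in (0 : ℝ)..t, E s with hG
  have hGd : ∀ t, HasDerivAt G (E t) t := fun t =>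
    intervalIntegral.integral_hasDerivAt_right (hEc.intervalIntegrable _ _)
      (hEc.stronglyMeasurableAtFilter _ _) hEc.continuousAt
  have hGD : ∀ t ∈ Icc (0 : ℝ) T, G t = ∫ s in (0 : ℝ)..t, D s := by
    intro t ht
    refine intervalIntegral.integral_congr fun s hs => hED s ?_
    rw [uIcc_of_le ht.1] at hs
    exact ⟨hs.1, hs.2.trans ht.2⟩
  have hE0 : ∀ t ∈ Icc (0 : ℝ) T, 0 ≤ E t := fun t ht => by
    rw [hED t ht]; exact norm_nonneg _
  have hG0 : ∀ t ∈ Icc (0 : ℝ) T, 0 ≤ G t := fun t ht =>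
    intervalIntegral.integral_nonneg ht.1 fun s hs => hE0 s ⟨hs.1, hs.2.trans ht.2⟩
  have hgron := norm_le_gronwallBound_of_norm_deriv_right_le (f := G) (f' := E) (δ := 0) (K := L)
    (ε := 0) (a := 0) (b := T)
    (fun t _ => (hGd t).continuousAt.continuousWithinAt)
    (fun t _ => (hGd t).hasDerivWithinAt) (by simp [hG])
    (fun t ht => by
      have ht' := Ico_subset_Icc_self ht
      rw [Real.norm_of_nonneg (hE0 t ht'), Real.norm_of_nonneg (hG0 t ht'), hED t ht', add_zero,
        hGD t ht']
      exact key t ht')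
  have hTm : T ∈ Icc (0 : ℝ) T := right_mem_Icc.2 hT
  have hGT : G T = 0 := by
    have := hgron T hTm
    rw [gronwallBound_ε0_δ0] at this
    exact norm_le_zero_iff.1 this
  have h1 := key T hTm
  rw [← hGD T hTm, hGT, mul_zero] at h1
  exact sub_eq_zero.1 (norm_le_zero_iff.1 h1)

theorem IsTrajectory.eq_transitionMap
    {f : EuclideanSpace ℝ (Fin n) → EuclideanSpace ℝ (Fin m) → EuclideanSpace ℝ (Fin n)}
    (hf : LipschitzFstOnBounded f) {x₀ : EuclideanSpace ℝ (Fin n)} {u : InputSpace m}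
    {ξ : ℝ → EuclideanSpace ℝ (Fin n)} (hξ : IsTrajectory f x₀ u ξ) (t : ℝ≥0) :
    transitionMap f t x₀ u = ξ t :=
  IsTrajectory.eqOn hf (Classical.epsilon_spec ⟨ξ, hξ⟩) hξ t.2

end ODE

/-!
Everything rests on two facts about a forward complete system `ẋ = f(x, v)` which is Lipschitz in
the state, but completely arbitrary in the input.

*Regularity for free.* Forward completeness alone forces `f` to be bounded on bounded sets
(`IsForwardCompleteSystem.exists_bound`) and `f(ζ, v)` to be integrable along every continuous curve
(`IsForwardCompleteSystem.intervalIntegrable_comp`). So solutions with bounded inputs are locally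
equi-Lipschitz as long as they stay bounded, and converge locally uniformly along ultrafilters.

*Shadowing.* A limit `χ` of solutions need not be a solution, since the set of velocities is neither
closed nor convex. Nevertheless there is a true solution which stays as close to `χ` as desired on
the whole, possibly infinite, time interval (`IsForwardCompleteSystem.exists_shadowing`). Its
input is glued from inputs of solutions that are very close to `χ` on successive intervals, and its
initial state is found by solving the equation backwards near `χ`
(`IsForwardCompleteSystem.exists_solution_near`). Going backwards, an error made late has to be
small only in comparison with the Lipschitz constants of *earlier* times, which are known
when the late input is chosen; in the forward direction errors could not be controlled forever.

Shadowing is used twice. If solutions from a bounded set with bounded inputs were unbounded in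
finite time, a limit would escape in finite time, and so would a solution shadowing it: reachability
sets are bounded (`IsForwardCompleteSystem.exists_reachability_bound`). If solutions took
arbitrarily long to make the output small, some solution would never do so: the limit property is
uniform (`IsForwardCompleteSystem.exists_uniform_time`). Together with the Lagrange estimate,
restarted at the time where the output is small, this gives the first equivalence.

For the second one, let `f(0, 0) = 0`. A solution starting at `0` can be delayed by an arbitrary
time with zero input, so the asymptotic gain bounds its output at *all* times; this replaces
continuity of `f` in the input. By Grönwall's inequality and boundedness of reachability sets,
the output is small for all times when the initial state and the input are small, and bounded when
they are bounded (`IsForwardCompleteSystem.exists_output_bound`). It remains to dominate the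
excess of the output over the gain by a function of class `𝒦ℒ`, which is done by an explicit
regularization of a supremum (`exists_isClassKL_majorant`).
-/

/-! ### Comparison functions: algebra and majorants -/

theorem NNReal.nhds_zero_hasBasis_Iic : (nhds (0 : ℝ≥0)).HasBasis (fun ε => 0 < ε) Iic :=
  nhds_bot_basis_Iic

theorem IsClassKInf.add {σ γ : ℝ≥0 → ℝ≥0} (hσ : IsClassKInf σ) (hγ : IsClassKInf γ) :
    IsClassKInf fun r => σ r + γ r := by
  refine ⟨⟨by simp [hσ.1.1, hγ.1.1], hσ.1.2.1.add hγ.1.2.1, hσ.1.2.2.add hγ.1.2.2⟩, ?_⟩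
  rintro ⟨C, hC⟩
  refine hσ.2 ⟨C, ?_⟩
  rintro _ ⟨r, rfl⟩
  exact le_self_add.trans (hC ⟨r, rfl⟩)

theorem IsClassKInf.exists_le {γ : ℝ≥0 → ℝ≥0} (hγ : IsClassKInf γ) (c : ℝ≥0) : ∃ r, c ≤ γ r := by
  by_contra! h
  exact hγ.2 ⟨c, by rintro _ ⟨r, rfl⟩; exact (h r).le⟩

theorem IsClassKInf.comp {σ γ : ℝ≥0 → ℝ≥0} (hσ : IsClassKInf σ) (hγ : IsClassKInf γ) :
    IsClassKInf fun r => σ (γ r) := by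
  refine ⟨⟨by simp [hσ.1.1, hγ.1.1], hσ.1.2.1.comp hγ.1.2.1, hσ.1.2.2.comp hγ.1.2.2⟩, ?_⟩
  rintro ⟨C, hC⟩
  obtain ⟨s, hs⟩ := hσ.exists_le (C + 1)
  obtain ⟨r, hr⟩ := hγ.exists_le s
  have h1 : σ (γ r) ≤ C := hC ⟨r, rfl⟩
  have h2 := hσ.1.2.2.monotone hr
  exact absurd ((hs.trans h2).trans h1) (by simp)

theorem IsClassK.exists_pos_le {γ : ℝ≥0 → ℝ≥0} (hγ : IsClassK γ) {ε : ℝ≥0} (hε : 0 < ε) :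
    ∃ δ, 0 < δ ∧ ∀ s ≤ δ, γ s ≤ ε := by
  have h0 : Filter.Tendsto γ (nhds 0) (nhds 0) := by
    have := hγ.2.1.tendsto 0
    rwa [hγ.1] at this
  have h1 := (h0.eventually (gt_mem_nhds hε))
  obtain ⟨δ, hδ, h2⟩ := NNReal.nhds_zero_hasBasis_Iic.eventually_iff.1 (by simpa using h1)
  exact ⟨δ, hδ, fun s hs => (h2 hs).le⟩

/-- The weak triangle inequality for monotone functions. -/
theorem Monotone.apply_add_le {σ : ℝ≥0 → ℝ≥0} (hσ : Monotone σ) (a b : ℝ≥0) :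
    σ (a + b) ≤ σ (2 * a) + σ (2 * b) := by
  rcases le_total a b with hab | hab
  · exact (hσ (by rw [two_mul]; gcongr)).trans le_add_self
  · exact (hσ (by rw [two_mul]; gcongr)).trans le_self_add

/-- A weight which equals `1` for `ρ ≤ r` and `0` for `2 * r ≤ ρ`, and is continuous in `r > 0`.
For `r = 0` the division by zero makes it vanish, also at `ρ = 0`. -/
noncomputable def cutoff (ρ r : ℝ≥0) : ℝ≥0 := min 1 ((2 * r - ρ) / r)

theorem cutoff_le_one (ρ r : ℝ≥0) : cutoff ρ r ≤ 1 := min_le_left _ _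

theorem cutoff_of_le {ρ r : ℝ≥0} (hr : 0 < r) (h : ρ ≤ r) : cutoff ρ r = 1 := by
  refine min_eq_left ?_
  rw [le_div_iff₀ hr, one_mul, le_tsub_iff_right (h.trans (by rw [two_mul]; exact le_self_add)),
    two_mul]
  gcongr

theorem cutoff_of_two_mul_le {ρ r : ℝ≥0} (h : 2 * r ≤ ρ) : cutoff ρ r = 0 := by
  simp [cutoff, tsub_eq_zero_of_le h]

theorem cutoff_eq {ρ r : ℝ≥0} (hr : 0 < r) : cutoff ρ r = min 1 (2 - ρ / r) := by
  rw [cutoff, NNReal.sub_div, mul_div_cancel_right₀ _ hr.ne']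

theorem cutoff_mono (ρ : ℝ≥0) : Monotone (cutoff ρ) := by
  intro r r' h
  rcases eq_zero_or_pos r with rfl | hr
  · simp [cutoff]
  · rw [cutoff_eq hr, cutoff_eq (hr.trans_le h)]
    gcongr

theorem cutoff_le_add {ρ r r' : ℝ≥0} (hr : 0 < r) (h : r ≤ r') :
    cutoff ρ r' ≤ cutoff ρ r + 2 * ((r' - r) / r) := by
  have hr' := hr.trans_le h
  rcases le_total (2 * r') ρ with h2 | h2
  · simp [cutoff_of_two_mul_le h2]
  rw [cutoff_eq hr, cutoff_eq hr', min_add]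
  refine min_le_min (by simp) ?_
  rw [tsub_le_iff_right]
  have key : ρ / r ≤ ρ / r' + 2 * ((r' - r) / r) := by
    rw [← NNReal.coe_le_coe]
    push_cast [NNReal.coe_sub h]
    have hr0 : (0 : ℝ) < r := hr
    have hr0' : (0 : ℝ) < r' := hr'
    have h3 : (r : ℝ) ≤ r' := h
    have h4 : (ρ : ℝ) ≤ 2 * r' := h2
    have : (ρ : ℝ) / r - ρ / r' = (ρ / r') * ((r' - r) / r) := by
      field_simp
    have h5 : (ρ : ℝ) / r' ≤ 2 := by rw [div_le_iff₀ hr0']; exact h4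
    have h6 : 0 ≤ ((r' : ℝ) - r) / r := div_nonneg (by linarith) hr0.le
    nlinarith
  calc (2 : ℝ≥0) ≤ (2 - ρ / r) + ρ / r := le_tsub_add
    _ ≤ (2 - ρ / r) + (ρ / r' + 2 * ((r' - r) / r)) := by gcongr
    _ = _ := by ring

section Envelope

variable {ι : Type*} {a ρ : ι → ℝ≥0}

/-- A regularized supremum of the values `a i` over sizes `ρ i ≤ r`: values of size up to `r` count
fully, values of size above `2 * r` not at all. If the values are bounded for bounded sizes and
small for small sizes, it is continuous and monotone in `r`. -/
noncomputable def envelope (a ρ : ι → ℝ≥0) (r : ℝ≥0) : ℝ≥0 := ⨆ i, a i * cutoff (ρ i) r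

theorem mul_cutoff_le {r C : ℝ≥0} (hC : ∀ i, ρ i ≤ 2 * r → a i ≤ C) (i : ι) :
    a i * cutoff (ρ i) r ≤ C := by
  rcases le_total (ρ i) (2 * r) with h | h
  · exact (mul_le_of_le_one_right' (cutoff_le_one _ _)).trans (hC i h)
  · simp [cutoff_of_two_mul_le h]

theorem envelope_le {r C : ℝ≥0} (hC : ∀ i, ρ i ≤ 2 * r → a i ≤ C) : envelope a ρ r ≤ C :=
  ciSup_le' (mul_cutoff_le hC)

theorem le_envelope_mul (hb : ∀ r, ∃ C, ∀ i, ρ i ≤ r → a i ≤ C) (r : ℝ≥0) (i : ι) :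
    a i * cutoff (ρ i) r ≤ envelope a ρ r := by
  obtain ⟨C, hC⟩ := hb (2 * r)
  refine le_ciSup (f := fun i => a i * cutoff (ρ i) r) ⟨C, ?_⟩ i
  rintro _ ⟨j, rfl⟩
  exact mul_cutoff_le hC j

theorem le_envelope (hb : ∀ r, ∃ C, ∀ i, ρ i ≤ r → a i ≤ C) {r : ℝ≥0} (hr : 0 < r) {i : ι}
    (hi : ρ i ≤ r) : a i ≤ envelope a ρ r := by
  simpa [cutoff_of_le hr hi] using le_envelope_mul hb r i

theorem envelope_mono (hb : ∀ r, ∃ C, ∀ i, ρ i ≤ r → a i ≤ C) : Monotone (envelope a ρ) := by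
  intro r r' h
  exact ciSup_le' fun i => (mul_le_mul_right (cutoff_mono _ h) _).trans (le_envelope_mul hb r' i)

theorem envelope_zero : envelope a ρ 0 = 0 := by
  refine le_antisymm (ciSup_le' fun i => ?_) zero_le
  simp [cutoff]

theorem envelope_le_add (hb : ∀ r, ∃ C, ∀ i, ρ i ≤ r → a i ≤ C) {r r' C : ℝ≥0} (hr : 0 < r)
    (h : r ≤ r') (hC : ∀ i, ρ i ≤ 2 * r' → a i ≤ C) :
    envelope a ρ r' ≤ envelope a ρ r + C * (2 * ((r' - r) / r)) := by
  refine ciSup_le' fun i => ?_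
  rcases le_total (ρ i) (2 * r') with hi | hi
  · calc a i * cutoff (ρ i) r' ≤ a i * (cutoff (ρ i) r + 2 * ((r' - r) / r)) := by
          gcongr; exact cutoff_le_add hr h
      _ = a i * cutoff (ρ i) r + a i * (2 * ((r' - r) / r)) := by ring
      _ ≤ _ := by gcongr; exacts [le_envelope_mul hb r i, hC i hi]
  · simp [cutoff_of_two_mul_le hi]

theorem continuous_envelope (hb : ∀ r, ∃ C, ∀ i, ρ i ≤ r → a i ≤ C)
    (hs : ∀ ε, 0 < ε → ∃ δ, 0 < δ ∧ ∀ i, ρ i ≤ δ → a i ≤ ε) : Continuous (envelope a ρ) := by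
  rw [continuous_iff_continuousAt]
  intro r₀
  rcases eq_zero_or_pos r₀ with rfl | hr₀
  · rw [ContinuousAt, envelope_zero, NNReal.nhds_zero_hasBasis_Iic.tendsto_iff
      NNReal.nhds_zero_hasBasis_Iic]
    intro ε hε
    obtain ⟨δ, hδ, h⟩ := hs ε hε
    refine ⟨δ / 2, half_pos hδ, fun r hr => envelope_le fun i hi => h i (hi.trans ?_)⟩
    have hr' : r ≤ δ / 2 := hr
    calc 2 * r ≤ 2 * (δ / 2) := by gcongr
      _ = δ := mul_div_cancel₀ _ two_ne_zero
  · obtain ⟨C, hC⟩ := hb (4 * r₀)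
    have hr₀' : (0 : ℝ) < r₀ := hr₀
    rw [ContinuousAt, tendsto_iff_dist_tendsto_zero]
    have hlim : Filter.Tendsto (fun r : ℝ≥0 => (C : ℝ) * (4 / r₀) * dist r r₀) (nhds r₀)
        (nhds 0) := by
      have : Filter.Tendsto (fun r : ℝ≥0 => dist r r₀) (nhds r₀) (nhds 0) :=
        tendsto_iff_dist_tendsto_zero.1 Filter.tendsto_id
      simpa using this.const_mul ((C : ℝ) * (4 / r₀))
    refine squeeze_zero' (Filter.Eventually.of_forall fun _ => dist_nonneg) ?_ hlim
    have h1 : ∀ᶠ r : ℝ≥0 in nhds r₀, r < 2 * r₀ :=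
      gt_mem_nhds (by rw [two_mul]; exact lt_add_of_pos_right _ hr₀)
    have h2 : ∀ᶠ r : ℝ≥0 in nhds r₀, r₀ / 2 < r := lt_mem_nhds (NNReal.half_lt_self hr₀.ne')
    filter_upwards [h1, h2] with r h1 h2
    have h1' : (r : ℝ) < 2 * r₀ := h1
    have h2' : (r₀ : ℝ) / 2 < r := h2
    rw [NNReal.dist_eq, NNReal.dist_eq]
    rcases le_total r r₀ with h | h
    · have hr : 0 < r := (half_pos hr₀).trans h2
      have hm : (envelope a ρ r : ℝ) ≤ envelope a ρ r₀ := envelope_mono hb h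
      have := envelope_le_add hb hr h
        (fun i hi => hC i (hi.trans (by gcongr; norm_num)))
      rw [← NNReal.coe_le_coe] at this
      push_cast [NNReal.coe_sub h] at this
      have h' : (r : ℝ) ≤ r₀ := h
      rw [abs_of_nonpos (by linarith), abs_of_nonpos (by linarith)]
      have h3 : 2 * (((r₀ : ℝ) - r) / r) ≤ 4 / r₀ * (r₀ - r) := by
        have : (2 : ℝ) / r ≤ 4 / r₀ := by
          rw [div_le_div_iff₀ (by exact_mod_cast hr) hr₀']; linarith
        calc 2 * (((r₀ : ℝ) - r) / r) = 2 / r * (r₀ - r) := by ring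
          _ ≤ _ := by gcongr
      have h4 := mul_le_mul_of_nonneg_left h3 C.coe_nonneg
      have h5 : (C : ℝ) * (4 / r₀ * (r₀ - r)) = C * (4 / r₀) * -(r - r₀) := by ring
      linarith
    · have hm : (envelope a ρ r₀ : ℝ) ≤ envelope a ρ r := envelope_mono hb h
      have := envelope_le_add hb hr₀ h (C := C)
        (fun i hi => hC i (hi.trans (by
          calc 2 * r ≤ 2 * (2 * r₀) := by gcongr
            _ = 4 * r₀ := by ring)))
      rw [← NNReal.coe_le_coe] at this
      push_cast [NNReal.coe_sub h] at this
      have h' : (r₀ : ℝ) ≤ r := h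
      rw [abs_of_nonneg (by linarith), abs_of_nonneg (by linarith)]
      have h3 : 2 * (((r : ℝ) - r₀) / r₀) ≤ 4 / r₀ * (r - r₀) := by
        calc 2 * (((r : ℝ) - r₀) / r₀) = 2 / r₀ * (r - r₀) := by ring
          _ ≤ _ := by gcongr; linarith
      have h4 := mul_le_mul_of_nonneg_left h3 C.coe_nonneg
      have h5 : (C : ℝ) * (4 / r₀ * (r - r₀)) = C * (4 / r₀) * (r - r₀) := by ring
      linarith

/-- A family of values which is bounded for bounded sizes and small for small sizes is dominated
by a function of class `𝒦∞` of the sizes. -/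
theorem exists_isClassKInf_majorant (hb : ∀ r, ∃ C, ∀ i, ρ i ≤ r → a i ≤ C)
    (hs : ∀ ε, 0 < ε → ∃ δ, 0 < δ ∧ ∀ i, ρ i ≤ δ → a i ≤ ε) :
    ∃ σ, IsClassKInf σ ∧ ∀ i, a i ≤ σ (ρ i) := by
  refine ⟨fun r => r + envelope a ρ r, ⟨⟨by simp [envelope_zero],
    continuous_id.add (continuous_envelope hb hs), strictMono_id.add_monotone (envelope_mono hb)⟩,
    ?_⟩, fun i => ?_⟩
  · rintro ⟨C, hC⟩
    have : (C + 1) + envelope a ρ (C + 1) ≤ C := hC ⟨C + 1, rfl⟩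
    exact absurd (le_self_add.trans this) (by simp)
  · rcases eq_zero_or_pos (ρ i) with h | h
    · have : a i = 0 := by
        refine le_antisymm (le_of_forall_pos_le_add fun ε hε => ?_) zero_le
        obtain ⟨δ, hδ, h'⟩ := hs ε hε
        simpa using h' i (by simp [h])
      simp [this]
    · exact (le_envelope hb h le_rfl).trans le_add_self

/-- If the values `a i`, attached to sizes `ρ i` and times `θ i`, are bounded for bounded sizes,
small for small sizes, and become small at large times uniformly for bounded sizes, then they are
dominated by a `𝒦ℒ` function of size and time. -/
theorem exists_isClassKL_majorant {θ : ι → ℝ≥0} (hb : ∀ r, ∃ C, ∀ i, ρ i ≤ r → a i ≤ C)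
    (hs : ∀ ε, 0 < ε → ∃ δ, 0 < δ ∧ ∀ i, ρ i ≤ δ → a i ≤ ε)
    (hd : ∀ ε r, 0 < ε → ∃ τ, ∀ i, ρ i ≤ r → τ ≤ θ i → a i ≤ ε) :
    ∃ β, IsClassKL β ∧ ∀ i, a i ≤ β (ρ i) (θ i) := by
  -- The time weight is `1` for `t ≤ θ i`, and `(1 + t)` times it is monotone in `t`.
  set w : ι → ℝ≥0 → ℝ≥0 := fun i t => min 1 ((1 + θ i) / (1 + t)) with hw
  set A : ℝ≥0 → ι → ℝ≥0 := fun t i => a i * w i t with hA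
  have hAle : ∀ t i, A t i ≤ a i := fun t i => mul_le_of_le_one_right' (min_le_left _ _)
  have hbA : ∀ t, ∀ r, ∃ C, ∀ i, ρ i ≤ r → A t i ≤ C := fun t r => by
    obtain ⟨C, hC⟩ := hb r
    exact ⟨C, fun i hi => (hAle t i).trans (hC i hi)⟩
  have hsA : ∀ t, ∀ ε, 0 < ε → ∃ δ, 0 < δ ∧ ∀ i, ρ i ≤ δ → A t i ≤ ε := fun t ε hε => by
    obtain ⟨δ, hδ, h⟩ := hs ε hε
    exact ⟨δ, hδ, fun i hi => (hAle t i).trans (h i hi)⟩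
  have hanti : ∀ r, Antitone fun t => envelope (A t) ρ r := by
    intro r t t' h
    refine ciSup_le' fun i => le_trans ?_ (le_envelope_mul (hbA t) r i)
    simp only [hA, hw]
    gcongr
  have hstep : ∀ r t t', t ≤ t' →
      envelope (A t) ρ r ≤ envelope (A t') ρ r * ((1 + t') / (1 + t)) := by
    intro r t t' h
    refine ciSup_le' fun i => ?_
    have hq : 1 ≤ (1 + t') / (1 + t) := by
      rw [one_le_div (by positivity)]; gcongr
    have h1 : w i t ≤ w i t' * ((1 + t') / (1 + t)) := by
      simp only [hw]
      rw [min_mul_of_nonneg _ _ zero_le]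
      refine min_le_min (by simpa using hq) (le_of_eq ?_)
      field_simp
    calc A t i * cutoff (ρ i) r ≤ (a i * (w i t' * ((1 + t') / (1 + t)))) * cutoff (ρ i) r := by
          simp only [hA]; gcongr
      _ = (A t' i * cutoff (ρ i) r) * ((1 + t') / (1 + t)) := by simp only [hA]; ring
      _ ≤ _ := by gcongr; exact le_envelope_mul (hbA t') r i
  have hcont : ∀ r, Continuous fun t => envelope (A t) ρ r := by
    intro r
    refine (LipschitzWith.of_dist_le_mul (K := envelope (A 0) ρ r) ?_).continuous
    have aux : ∀ t t' : ℝ≥0, t ≤ t' → dist (envelope (A t) ρ r) (envelope (A t') ρ r) ≤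
        envelope (A 0) ρ r * dist t t' := by
      intro t t' h
      have h1 : (envelope (A t') ρ r : ℝ) ≤ envelope (A t) ρ r := hanti r h
      have h2 : (envelope (A t') ρ r : ℝ) ≤ envelope (A 0) ρ r := hanti r zero_le
      have h3 := hstep r t t' h
      rw [← NNReal.coe_le_coe] at h3
      push_cast at h3
      have h' : (t : ℝ) ≤ t' := h
      have ht : (0 : ℝ) ≤ t := t.2
      have h4 : ((1 : ℝ) + t') / (1 + t) ≤ 1 + (t' - t) := by
        rw [div_le_iff₀ (by positivity)]
        nlinarith
      have h5 : (0 : ℝ) ≤ envelope (A t') ρ r := NNReal.coe_nonneg _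
      rw [NNReal.dist_eq, NNReal.dist_eq, abs_of_nonneg (by linarith), abs_of_nonpos (by linarith)]
      have h6 := mul_le_mul_of_nonneg_left h4 h5
      have h7 : (envelope (A t') ρ r : ℝ) * (t' - t) ≤ envelope (A 0) ρ r * (t' - t) :=
        mul_le_mul_of_nonneg_right h2 (by linarith)
      linarith
    intro t t'
    rcases le_total t t' with h | h
    · exact aux t t' h
    · rw [dist_comm, dist_comm t]; exact aux t' t h
  have hlim : ∀ r, Filter.Tendsto (fun t => envelope (A t) ρ r) Filter.atTop (nhds 0) := by
    intro r
    rw [NNReal.nhds_zero_hasBasis_Iic.tendsto_right_iff]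
    intro ε hε
    obtain ⟨τ, hτ⟩ := hd ε (2 * r) hε
    obtain ⟨C, hC⟩ := hb (2 * r)
    filter_upwards [Filter.eventually_ge_atTop (C * (1 + τ) / ε)] with t ht
    refine envelope_le fun i hi => ?_
    rcases le_total τ (θ i) with h | h
    · exact (hAle t i).trans (hτ i hi h)
    · calc A t i ≤ C * ((1 + τ) / (1 + t)) := by
            simp only [hA, hw]
            gcongr
            · exact hC i hi
            · exact (min_le_right _ _).trans (by gcongr)
        _ = C * (1 + τ) / (1 + t) := by rw [mul_div_assoc]
        _ ≤ ε := by
            rw [div_le_iff₀ hε] at ht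
            rw [div_le_iff₀ (by positivity)]
            calc C * (1 + τ) ≤ t * ε := ht
              _ ≤ ε * (1 + t) := by rw [mul_comm]; gcongr; exact le_add_self
  refine ⟨fun r t => r / (1 + t) + envelope (A t) ρ r, ⟨fun t => ⟨by simp [envelope_zero], ?_, ?_⟩,
    fun r _ => ⟨?_, ?_, ?_⟩⟩, fun i => ?_⟩
  · exact (continuous_id.div_const _).add (continuous_envelope (hbA t) (hsA t))
  · refine StrictMono.add_monotone (fun r r' h => ?_) (envelope_mono (hbA t))
    exact div_lt_div_of_pos_right h (by positivity)
  · refine Continuous.add (Continuous.div continuous_const (by fun_prop) fun t => ?_) (hcont r)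
    positivity
  · refine Antitone.add (fun t t' h => ?_) (hanti r)
    gcongr
  · have h1 : Filter.Tendsto (fun t : ℝ≥0 => r / (1 + t)) Filter.atTop (nhds 0) :=
by
      rw [← NNReal.tendsto_coe]
      push_cast
      exact Filter.Tendsto.const_div_atTop
        (Filter.tendsto_atTop_add_const_left _ _ (NNReal.tendsto_coe_atTop.2 Filter.tendsto_id)) _
    simpa using h1.add (hlim r)
  · rcases eq_zero_or_pos (ρ i) with h | h
    · have : a i = 0 := by
        refine le_antisymm (le_of_forall_pos_le_add fun ε hε => ?_) zero_le
        obtain ⟨δ, hδ, h'⟩ := hs ε hε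
        simpa using h' i (by simp [h])
      simp [this]
    · have hwi : w i (θ i) = 1 := by
        simp only [hw]
        rw [div_self (by positivity), min_self]
      have : a i = A (θ i) i := by simp [hA, hwi]
      rw [this]
      exact (le_envelope (hbA (θ i)) h le_rfl).trans le_add_self

end Envelope

/-! ### Solutions of differential equations with measurable inputs -/

section Systems

variable {E V : Type*} [NormedAddCommGroup E] [NormedSpace ℝ E] [NormedAddCommGroup V]
  [MeasurableSpace V]

/-- `ξ` solves `ẋ = f(x, v)` on `[a, b]`, in integral form. -/
def IsSolutionOn (f : E → V → E) (v : ℝ → V) (a b : ℝ) (ξ : ℝ → E) : Prop :=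
  ContinuousOn ξ (Icc a b) ∧ IntervalIntegrable (fun s => f (ξ s) (v s)) volume a b ∧
    ∀ t ∈ Icc a b, ξ t = ξ a + ∫ s in a..t, f (ξ s) (v s)

/-- Measurable inputs with values of norm at most `R`. The bound holds everywhere and on all of
`ℝ`, so that no null sets and no boundary of the time domain have to be carried along; every
class in `InputSpace` has such a representative on `[0, ∞)`. -/
structure IsInput (v : ℝ → V) (R : ℝ) : Prop where
  measurable : Measurable v
  norm_le : ∀ s, ‖v s‖ ≤ R

/-- A forward complete system whose right-hand side is Lipschitz in the state on bounded sets. -/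
structure IsForwardCompleteSystem (f : E → V → E) : Prop where
  lipschitz : ∀ r : ℝ, ∃ L : ℝ, 0 < L ∧ ∀ x₁ x₂ : E, ∀ v : V,
    ‖x₁‖ ≤ r → ‖x₂‖ ≤ r → ‖v‖ ≤ r → ‖f x₁ v - f x₂ v‖ ≤ L * ‖x₁ - x₂‖
  exists_solution : ∀ (v : ℝ → V) (R : ℝ), IsInput v R → ∀ x : E, ∃ ξ : ℝ → E, ξ 0 = x ∧
    ∀ T, 0 ≤ T → IsSolutionOn f v 0 T ξ

variable {f : E → V → E} {v : ℝ → V} {ξ ζ : ℝ → E} {a b c d R : ℝ}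

omit [NormedSpace ℝ E] in
theorem IsInput.comp_add (hv : IsInput v R) (c : ℝ) : IsInput (fun s => v (s + c)) R :=
  ⟨hv.measurable.comp (measurable_id.add_const c), fun _ => hv.norm_le _⟩

omit [NormedAddCommGroup V] [MeasurableSpace V] in
theorem IsSolutionOn.sub_eq (h : IsSolutionOn f v a b ξ) {s t : ℝ} (hs : s ∈ Icc a b)
    (ht : t ∈ Icc a b) : ξ t - ξ s = ∫ r in s..t, f (ξ r) (v r) := by
  have hab : a ≤ b := hs.1.trans hs.2
  have hi : ∀ r ∈ Icc a b, IntervalIntegrable (fun s => f (ξ s) (v s)) volume a r := fun r hr =>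
    h.2.1.mono_set (by rw [uIcc_of_le hr.1, uIcc_of_le hab]; exact Icc_subset_Icc_right hr.2)
  rw [h.2.2 t ht, h.2.2 s hs, add_sub_add_left_eq_sub,
    intervalIntegral.integral_interval_sub_left (hi t ht) (hi s hs)]

omit [NormedAddCommGroup V] [MeasurableSpace V] in
theorem IsSolutionOn.mono (h : IsSolutionOn f v a b ξ) (hac : a ≤ c) (hcd : c ≤ d) (hdb : d ≤ b) :
    IsSolutionOn f v c d ξ := by
  refine ⟨h.1.mono (Icc_subset_Icc hac hdb), h.2.1.mono_set ?_, fun t ht => ?_⟩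
  · rw [uIcc_of_le hcd, uIcc_of_le (hac.trans (hcd.trans hdb))]
    exact Icc_subset_Icc hac hdb
  · rw [← h.sub_eq ⟨hac, hcd.trans hdb⟩ ⟨hac.trans ht.1, ht.2.trans hdb⟩]
    abel

omit [NormedAddCommGroup V] [MeasurableSpace V] in
theorem IsSolutionOn.congr_input {w : ℝ → V} (h : IsSolutionOn f v a b ξ) (hab : a ≤ b)
    (hvw : ∀ᵐ s, s ∈ Ioc a b → v s = w s) : IsSolutionOn f w a b ξ := by
  have key : ∀ t ∈ Icc a b, ∀ᵐ s, s ∈ uIoc a t → f (ξ s) (v s) = f (ξ s) (w s) := fun t ht => by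
    filter_upwards [hvw] with s hs hst
    rw [uIoc_of_le ht.1] at hst
    rw [hs ⟨hst.1, hst.2.trans ht.2⟩]
  refine ⟨h.1, h.2.1.congr_ae ?_, fun t ht => ?_⟩
  · exact (ae_restrict_iff' measurableSet_uIoc).2 (key b ⟨hab, le_rfl⟩)
  · rw [h.2.2 t ht, intervalIntegral.integral_congr_ae (key t ht)]

omit [NormedAddCommGroup V] [MeasurableSpace V] in
theorem IsSolutionOn.congr_curve (h : IsSolutionOn f v a b ξ) (hab : a ≤ b)
    (hξζ : EqOn ξ ζ (Icc a b)) : IsSolutionOn f v a b ζ := by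
  refine ⟨h.1.congr hξζ.symm, h.2.1.congr fun s hs => ?_, fun t ht => ?_⟩
  · rw [uIoc_of_le hab] at hs
    simp only [hξζ (Ioc_subset_Icc_self hs)]
  · rw [← hξζ ht, ← hξζ ⟨le_rfl, hab⟩, h.2.2 t ht]
    congr 1
    refine intervalIntegral.integral_congr fun s hs => ?_
    rw [uIcc_of_le ht.1] at hs
    simp only [hξζ ⟨hs.1, hs.2.trans ht.2⟩]

omit [NormedAddCommGroup V] [MeasurableSpace V] in
theorem IsSolutionOn.trans (h₁ : IsSolutionOn f v a b ξ) (h₂ : IsSolutionOn f v b c ξ)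
    (hab : a ≤ b) (hbc : b ≤ c) : IsSolutionOn f v a c ξ := by
  refine ⟨?_, h₁.2.1.trans h₂.2.1, fun t ht => ?_⟩
  · rw [← Icc_union_Icc_eq_Icc hab hbc]
    exact h₁.1.union_of_isClosed h₂.1 isClosed_Icc isClosed_Icc
  · rcases le_total t b with htb | htb
    · exact h₁.2.2 t ⟨ht.1, htb⟩
    · have h3 := (h₂.mono le_rfl htb ht.2).2.1
      rw [h₂.2.2 t ⟨htb, ht.2⟩, h₁.2.2 b ⟨hab, le_rfl⟩, add_assoc,
        intervalIntegral.integral_add_adjacent_intervals h₁.2.1 h3]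

omit [NormedAddCommGroup V] [MeasurableSpace V] in
theorem IsSolutionOn.comp_add (h : IsSolutionOn f v a b ξ) (c : ℝ) :
    IsSolutionOn f (fun s => v (s + c)) (a - c) (b - c) (fun s => ξ (s + c)) := by
  refine ⟨h.1.comp (by fun_prop) fun s hs => ?_, ?_, fun t ht => ?_⟩
  · exact ⟨by linarith [hs.1], by linarith [hs.2]⟩
  · exact h.2.1.comp_add_right c
  · have := intervalIntegral.integral_comp_add_right (a := a - c) (b := t)
      (fun s => f (ξ s) (v s)) c
    simp only [sub_add_cancel] at this ⊢
    rw [this]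
    exact h.2.2 _ ⟨by linarith [ht.1], by linarith [ht.2]⟩

theorem IsSolutionOn.norm_sub_le (h : IsSolutionOn f v a b ξ) (hv : IsInput v R) {r M : ℝ}
    (hM : ∀ x u, ‖x‖ ≤ r → ‖u‖ ≤ R → ‖f x u‖ ≤ M) (hξ : ∀ s ∈ Icc a b, ‖ξ s‖ ≤ r) {s t : ℝ}
    (hs : s ∈ Icc a b) (ht : t ∈ Icc a b) : ‖ξ t - ξ s‖ ≤ M * |t - s| := by
  rw [h.sub_eq hs ht]
  refine intervalIntegral.norm_integral_le_of_norm_le_const fun q hq =>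
    hM _ _ (hξ q ?_) (hv.norm_le q)
  exact uIcc_subset_Icc hs ht (uIoc_subset_uIcc hq)

/-- A solution starting in the ball of radius `K` moves by less than `1` during a time which
depends only on a bound for `f` on the ball of radius `K + 1`. -/
theorem IsSolutionOn.norm_sub_le_of_short (h : IsSolutionOn f v a b ξ) (hv : IsInput v R)
    {K M : ℝ} (hM : ∀ x u, ‖x‖ ≤ K + 1 → ‖u‖ ≤ R → ‖f x u‖ ≤ M) (hM0 : 0 ≤ M) (ha : ‖ξ a‖ ≤ K)
    (hab : (b - a) * M < 1) {t : ℝ} (ht : t ∈ Icc a b) : ‖ξ t - ξ a‖ ≤ M * (t - a) := by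
  have key : ∀ t ∈ Icc a b, (∀ s ∈ Ico a t, ‖ξ s - ξ a‖ < 1) → ‖ξ t - ξ a‖ ≤ M * (t - a) := by
    intro t ht hlt
    rw [h.sub_eq ⟨le_rfl, ht.1.trans ht.2⟩ ht]
    have := intervalIntegral.norm_integral_le_of_norm_le_const_ae (a := a) (b := t) (C := M)
      (f := fun s => f (ξ s) (v s)) ?_
    · rwa [abs_of_nonneg (by linarith [ht.1])] at this
    have hne : ∀ᵐ s : ℝ, s ≠ t := by simp [ae_iff, measure_singleton]
    filter_upwards [hne] with s hst hs
    rw [uIoc_of_le ht.1] at hs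
    refine hM _ _ ?_ (hv.norm_le s)
    have h1 := hlt s ⟨hs.1.le, lt_of_le_of_ne hs.2 hst⟩
    have h2 := norm_le_norm_add_norm_sub' (ξ s) (ξ a)
    linarith
  refine key t ht fun s hs => ?_
  by_contra hcon
  have hsb : s ∈ Icc a b := ⟨hs.1, hs.2.le.trans ht.2⟩
  have hcont : ContinuousOn (fun s => ‖ξ s - ξ a‖) (Icc a b) := (h.1.sub continuousOn_const).norm
  have hcl : IsCompact (Icc a b ∩ (fun s => ‖ξ s - ξ a‖) ⁻¹' Ici 1) :=
    isCompact_Icc.of_isClosed_subset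
      (hcont.preimage_isClosed_of_isClosed isClosed_Icc isClosed_Ici) inter_subset_left
  obtain ⟨q, ⟨hq, hq1⟩, hmin⟩ := hcl.exists_isLeast ⟨s, hsb, not_lt.1 hcon⟩
  have h1 := key q hq fun p hp => by
    by_contra hp1
    exact absurd (hmin ⟨⟨hp.1, hp.2.le.trans hq.2⟩, not_lt.1 hp1⟩) (not_le.2 hp.2)
  have h2 : (1 : ℝ) ≤ ‖ξ q - ξ a‖ := hq1
  have h3 : M * (q - a) ≤ (b - a) * M := by
    rw [mul_comm]; gcongr; exact hq.2
  linarith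

omit [NormedAddCommGroup V] [MeasurableSpace V] in
/-- Continuous dependence on the initial state (Grönwall). -/
theorem IsSolutionOn.norm_sub_le_exp (h : IsSolutionOn f v a b ξ) (h' : IsSolutionOn f v a b ζ)
    {L : ℝ} (hL : 0 < L)
    (hLip : ∀ s ∈ Icc a b, ‖f (ξ s) (v s) - f (ζ s) (v s)‖ ≤ L * ‖ξ s - ζ s‖) {t : ℝ}
    (ht : t ∈ Icc a b) : ‖ξ t - ζ t‖ ≤ ‖ξ a - ζ a‖ * Real.exp (L * (t - a)) := by
  have hab : a ≤ b := ht.1.trans ht.2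
  set D : ℝ → ℝ := fun t => ‖ξ t - ζ t‖ with hD
  have hDc : ContinuousOn D (Icc a b) := (h.1.sub h'.1).norm
  have key : ∀ t ∈ Icc a b, D t ≤ D a + L * ∫ s in a..t, D s := by
    intro t ht
    have hsub : ξ t - ζ t = (ξ a - ζ a) + ∫ s in a..t, (f (ξ s) (v s) - f (ζ s) (v s)) := by
      rw [intervalIntegral.integral_sub (h.mono le_rfl ht.1 ht.2).2.1
        (h'.mono le_rfl ht.1 ht.2).2.1, h.2.2 t ht, h'.2.2 t ht]
      abel
    have hDi : IntervalIntegrable D volume a t :=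
      (hDc.mono (by rw [uIcc_of_le ht.1]; exact Icc_subset_Icc_right ht.2)).intervalIntegrable
    simp only [hD]
    rw [hsub, ← intervalIntegral.integral_const_mul]
    refine (norm_add_le _ _).trans (add_le_add_right ?_ _)
    refine intervalIntegral.norm_integral_le_of_norm_le ht.1 ?_ (hDi.const_mul L)
    exact Filter.Eventually.of_forall fun s hs => hLip s ⟨hs.1.le, hs.2.trans ht.2⟩
  -- Grönwall for the primitive of a continuous extension of `D`
  set Q : ℝ → ℝ := IccExtend hab ((Icc a b).domRestrict D) with hQ
  have hQc : Continuous Q := (continuousOn_iff_continuous_domRestrict.1 hDc).Icc_extend'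
  have hQD : ∀ t ∈ Icc a b, Q t = D t := fun t ht => by
    rw [hQ, IccExtend_of_mem hab _ ht]; rfl
  set G : ℝ → ℝ := fun t => ∫ s in a..t, Q s with hG
  have hGd : ∀ t, HasDerivAt G (Q t) t := fun t =>
    intervalIntegral.integral_hasDerivAt_right (hQc.intervalIntegrable _ _)
      (hQc.stronglyMeasurableAtFilter _ _) hQc.continuousAt
  have hGD : ∀ t ∈ Icc a b, G t = ∫ s in a..t, D s := by
    intro t ht
    refine intervalIntegral.integral_congr fun s hs => hQD s ?_
    rw [uIcc_of_le ht.1] at hs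
    exact ⟨hs.1, hs.2.trans ht.2⟩
  have hQ0 : ∀ t ∈ Icc a b, 0 ≤ Q t := fun t ht => by
    rw [hQD t ht]; exact norm_nonneg _
  have hG0 : ∀ t ∈ Icc a b, 0 ≤ G t := fun t ht =>
    intervalIntegral.integral_nonneg ht.1 fun s hs => hQ0 s ⟨hs.1, hs.2.trans ht.2⟩
  have hgron := norm_le_gronwallBound_of_norm_deriv_right_le (f := G) (f' := Q) (δ := 0) (K := L)
    (ε := D a) (a := a) (b := b)
    (fun t _ => (hGd t).continuousAt.continuousWithinAt)
    (fun t _ => (hGd t).hasDerivWithinAt) (by simp [hG])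
    (fun t ht => by
      have ht' := Ico_subset_Icc_self ht
      rw [Real.norm_of_nonneg (hQ0 t ht'), Real.norm_of_nonneg (hG0 t ht'), hQD t ht',
        hGD t ht', add_comm]
      exact key t ht')
  have h1 := hgron t ht
  rw [gronwallBound_of_K_ne_0 hL.ne', Real.norm_of_nonneg (hG0 t ht), hGD t ht] at h1
  have h2 := key t ht
  have h3 : L * (0 * Real.exp (L * (t - a)) + D a / L * (Real.exp (L * (t - a)) - 1)) =
      D a * (Real.exp (L * (t - a)) - 1) := by
    field_simp; ring
  have h4 := mul_le_mul_of_nonneg_left h1 hL.le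
  rw [h3] at h4
  change D t ≤ D a * _
  linarith

namespace IsForwardCompleteSystem

variable (hf : IsForwardCompleteSystem f)
include hf

theorem exists_solution_from (hv : IsInput v R) (a : ℝ) (x : E) :
    ∃ ξ : ℝ → E, ξ a = x ∧ ∀ b, a ≤ b → IsSolutionOn f v a b ξ := by
  obtain ⟨ξ, h0, h⟩ := hf.exists_solution _ R (hv.comp_add a) x
  refine ⟨fun s => ξ (s + -a), by simpa using h0, fun b hb => ?_⟩
  simpa using (h (b - a) (by linarith)).comp_add (-a)

/-- Although nothing is assumed about the dependence of `f` on the input, forward completeness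
forces `f` to be bounded on bounded sets: otherwise an input running through values where `f` is
large, on intervals which are not short enough, makes `f(ξ, v)` non-integrable. -/
theorem exists_bound (r : ℝ) : ∃ M, 0 < M ∧ ∀ x u, ‖x‖ ≤ r → ‖u‖ ≤ r → ‖f x u‖ ≤ M := by
  have main : ∃ C, ∀ u, ‖u‖ ≤ r → ‖f 0 u‖ ≤ C := by
    by_contra! hcon
    choose u hur hu using fun k : ℕ => hcon ((k : ℝ) ^ 2 * (k + 1))
    -- the value `u k` is taken on `(1 / (k + 1), 1 / k]`
    set v : ℝ → V := fun s => u ⌊1 / s⌋₊ with hvdef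
    have hv : IsInput v r := ⟨measurable_from_nat.comp (Nat.measurable_floor.comp (by fun_prop)),
      fun s => hur _⟩
    obtain ⟨ξ, -, hξ⟩ := hf.exists_solution v r hv 0
    have h1 := hξ 1 zero_le_one
    obtain ⟨K, hK⟩ := isCompact_Icc.exists_bound_of_continuousOn h1.1
    have hK0 : 0 ≤ K := (norm_nonneg _).trans (hK 0 (by simp))
    obtain ⟨L, hL, hLip⟩ := hf.lipschitz (max K r)
    have hint : IntegrableOn (fun s => ‖f (ξ s) (v s)‖) (Ioc 0 1) :=
      ((intervalIntegrable_iff_integrableOn_Ioc_of_le zero_le_one).1 h1.2.1).norm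
    set C := ∫ s in Ioc (0 : ℝ) 1, ‖f (ξ s) (v s)‖ with hC
    have hlow : ∀ k : ℕ, 1 ≤ k → (k : ℝ) - L * K ≤ C := by
      intro k hk
      have hk0 : (0 : ℝ) < k := by exact_mod_cast hk
      have hk1 : (1 : ℝ) ≤ k := by exact_mod_cast hk
      set J := Ioc (1 / ((k : ℝ) + 1)) (1 / k) with hJ
      have hJsub : J ⊆ Ioc 0 1 := Ioc_subset_Ioc (by positivity) (by
        rw [div_le_one hk0]; exact hk1)
      have hJC : ∫ s in J, ‖f (ξ s) (v s)‖ ≤ C :=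
        setIntegral_mono_set hint (Filter.Eventually.of_forall fun s => norm_nonneg _)
          hJsub.eventuallyLE
      have hfl : ∀ s ∈ J, (k : ℝ) ^ 2 * (k + 1) - L * K ≤ ‖f (ξ s) (v s)‖ := by
        intro s hs
        have hs0 : 0 < s := lt_trans (by positivity) hs.1
        have hfloor : ⌊1 / s⌋₊ = k := by
          rw [Nat.floor_eq_iff (by positivity)]
          constructor
          · rw [le_div_comm₀ hk0 hs0]; exact hs.2
          · rw [div_lt_comm₀ hs0 (by positivity)]; exact hs.1
        have hvs : v s = u k := by simp only [hvdef, hfloor]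
        have hs1 : s ∈ Icc (0 : ℝ) 1 := Ioc_subset_Icc_self (hJsub hs)
        have h2 := hLip 0 (ξ s) (v s) (by simp [hK0]) ((hK s hs1).trans (by simp))
          ((hv.norm_le s).trans (by simp))
        rw [zero_sub, norm_neg] at h2
        have h3 := hu k
        have h4 := norm_le_norm_add_norm_sub' (f 0 (v s)) (f (ξ s) (v s))
        have h5 := mul_le_mul_of_nonneg_left (hK s hs1) hL.le
        rw [hvs] at h2 h4 ⊢
        linarith
      have hJint : ∫ _ in J, ((k : ℝ) ^ 2 * (k + 1) - L * K) ≤ ∫ s in J, ‖f (ξ s) (v s)‖ :=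
        setIntegral_mono_on (integrableOn_const (by simp [hJ])) (hint.mono_set hJsub)
          measurableSet_Ioc hfl
      have hlen : (1 / (k : ℝ) - 1 / (k + 1)) = 1 / (k * (k + 1)) := by field_simp; ring
      rw [setIntegral_const, hJ, measureReal_def, Real.volume_Ioc, hlen,
        ENNReal.toReal_ofReal (by positivity), smul_eq_mul] at hJint
      have h6 : 1 / ((k : ℝ) * (k + 1)) * ((k : ℝ) ^ 2 * (k + 1) - L * K) =
          k - L * K * (1 / (k * (k + 1))) := by field_simp
      have h7 : 1 / ((k : ℝ) * (k + 1)) ≤ 1 := by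
        rw [div_le_one (by positivity)]; nlinarith
      have h8 : L * K * (1 / ((k : ℝ) * (k + 1))) ≤ L * K :=
        mul_le_of_le_one_right (by positivity) h7
      linarith
    obtain ⟨k, hk⟩ := exists_nat_gt (max 1 (C + L * K))
    have h9 := hlow k (by exact_mod_cast ((le_max_left _ _).trans hk.le : (1 : ℝ) ≤ k))
    have h10 := (le_max_right (1 : ℝ) (C + L * K)).trans_lt hk
    linarith
  obtain ⟨C, hC⟩ := main
  obtain ⟨L, hL, hLip⟩ := hf.lipschitz r
  refine ⟨max 1 (C + L * r), lt_max_of_lt_left one_pos, fun x u hx hu => le_max_of_le_right ?_⟩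
  have h1 := hLip x 0 u hx (by simpa using (norm_nonneg x).trans hx) hu
  have h2 := hC u hu
  have h3 := norm_le_norm_add_norm_sub' (f x u) (f 0 u)
  rw [sub_zero] at h1
  have h4 := mul_le_mul_of_nonneg_left hx hL.le
  linarith

/-- Along every continuous curve `ζ`, not only along solutions, `s ↦ f(ζ(s), v(s))` is integrable.
Measurability holds because the curve is approximated by solutions restarted on it at the points
of a fine partition. -/
theorem intervalIntegrable_comp (hv : IsInput v R) (hab : a ≤ b) (hζ : ContinuousOn ζ (Icc a b)) :
    IntervalIntegrable (fun s => f (ζ s) (v s)) volume a b := by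
  obtain ⟨K, hK⟩ := isCompact_Icc.exists_bound_of_continuousOn hζ
  obtain ⟨M, hM, hMb⟩ := hf.exists_bound (max (K + 1) R)
  obtain ⟨L, hL, hLip⟩ := hf.lipschitz (max (K + 1) R)
  have happrox : ∀ ε > 0, ∃ g : ℝ → E, AEStronglyMeasurable g (volume.restrict (Ioc a b)) ∧
      ∀ s ∈ Ioc a b, ‖g s - f (ζ s) (v s)‖ ≤ ε := by
    intro ε hε
    obtain ⟨δ₀, hδ₀, huc⟩ := Metric.uniformContinuousOn_iff.1
      (isCompact_Icc.uniformContinuousOn_of_continuous hζ) (ε / (2 * L)) (by positivity)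
    set δ := min (δ₀ / 2) (min (1 / (2 * M)) (ε / (2 * L * M))) with hδdef
    have hδ : 0 < δ := by positivity
    have hstep : ∀ k : ℕ, ∃ g : ℝ → E,
        AEStronglyMeasurable g (volume.restrict (Ioc a (min (a + k * δ) b))) ∧
        ∀ s ∈ Ioc a (min (a + k * δ) b), ‖g s - f (ζ s) (v s)‖ ≤ ε := by
      intro k
      induction k with
      | zero => exact ⟨0, aestronglyMeasurable_zero, fun s hs => by simp [hab] at hs⟩
      | succ k ih =>
        obtain ⟨g, hg, hgε⟩ := ih
        set p := min (a + k * δ) b with hp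
        set q := min (a + (k + 1 : ℕ) * δ) b with hq
        have hpa : p ∈ Icc a b := ⟨le_min (by linarith [show 0 ≤ k * δ by positivity]) hab,
          min_le_right _ _⟩
        have hpq : p ≤ q := min_le_min_right _ (by push_cast; nlinarith)
        have hqb : q ≤ b := min_le_right _ _
        have hqp : q - p ≤ δ := by
          rcases le_total (a + k * δ) b with h | h
          · rw [hp, min_eq_left h]
            have := min_le_left (a + (k + 1 : ℕ) * δ) b
            push_cast at this
            rw [hq]; push_cast; linarith
          · rw [hp, min_eq_right h]; linarith
        obtain ⟨ψ, hψp, hψ⟩ := hf.exists_solution_from hv p (ζ p)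
        have hψq := hψ q hpq
        refine ⟨fun s => if s ≤ p then g s else f (ψ s) (v s), ?_, fun s hs => ?_⟩
        · rw [← Ioc_union_Ioc_eq_Ioc hpa.1 hpq, aestronglyMeasurable_union_iff]
          constructor
          · refine hg.congr ?_
            filter_upwards [ae_restrict_mem measurableSet_Ioc] with s hs
            simp [hs.2]
          · have := (intervalIntegrable_iff_integrableOn_Ioc_of_le hpq).1 hψq.2.1
            refine this.aestronglyMeasurable.congr ?_
            filter_upwards [ae_restrict_mem measurableSet_Ioc] with s hs
            simp [hs.1]
        · by_cases hsp : s ≤ p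
          · simpa [hsp] using hgε s ⟨hs.1, hsp⟩
          · simp only [hsp, if_false]
            push Not at hsp
            have hsb : s ∈ Icc a b := ⟨hs.1.le, hs.2.trans hqb⟩
            have hδM : δ * M < 1 := by
              have : δ ≤ 1 / (2 * M) := (min_le_right _ _).trans (min_le_left _ _)
              calc δ * M ≤ 1 / (2 * M) * M := by gcongr
                _ = 1 / 2 := by field_simp
                _ < 1 := by norm_num
            have h1 := hψq.norm_sub_le_of_short hv (K := K) (M := M)
              (fun x u hx hu => hMb x u (hx.trans (by simp)) (hu.trans (by simp))) hM.le
              (by rw [hψp]; exact hK p hpa)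
              (lt_of_le_of_lt (by gcongr) hδM) ⟨hsp.le, hs.2⟩
            have hsδ : s - p ≤ δ := by linarith [hs.2]
            have h2 : M * (s - p) ≤ ε / (2 * L) := by
              have : δ ≤ ε / (2 * L * M) := (min_le_right _ _).trans (min_le_right _ _)
              calc M * (s - p) ≤ M * (ε / (2 * L * M)) := by gcongr; linarith
                _ = ε / (2 * L) := by field_simp
            have h3 : ‖ζ p - ζ s‖ ≤ ε / (2 * L) := by
              rw [← dist_eq_norm]
              refine (huc p hpa s hsb ?_).le
              rw [Real.dist_eq, abs_of_nonpos (by linarith)]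
              have : δ ≤ δ₀ / 2 := min_le_left _ _
              linarith
            have h4 : ‖ψ s - ζ s‖ ≤ ε / L := by
              have : ψ s - ζ s = (ψ s - ψ p) + (ζ p - ζ s) := by rw [hψp]; abel
              rw [this]
              refine (norm_add_le _ _).trans ((add_le_add (h1.trans h2) h3).trans (le_of_eq ?_))
              field_simp; ring
            have h5 : ‖ψ s‖ ≤ K + 1 := by
              have h6 := norm_le_norm_add_norm_sub' (ψ s) (ψ p)
              have h7 : M * (s - p) ≤ δ * M := by rw [mul_comm]; gcongr
              rw [hψp] at h6 h1
              have := hK p hpa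
              linarith
            calc ‖f (ψ s) (v s) - f (ζ s) (v s)‖ ≤ L * ‖ψ s - ζ s‖ :=
                  hLip _ _ _ (h5.trans (by simp))
                    (((hK s hsb).trans (by linarith)).trans (le_max_left (K + 1) R))
                    ((hv.norm_le s).trans (by simp))
              _ ≤ L * (ε / L) := by gcongr
              _ = ε := by field_simp
    obtain ⟨k, hk⟩ := exists_nat_ge ((b - a) / δ)
    obtain ⟨g, hg⟩ := hstep k
    rw [div_le_iff₀ hδ] at hk
    rw [min_eq_right (by linarith)] at hg
    exact ⟨g, hg⟩
  rw [intervalIntegrable_iff_integrableOn_Ioc_of_le hab]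
  choose g hg hgε using fun k : ℕ => happrox (1 / ((k : ℝ) + 1)) (by positivity)
  have hmeas : AEStronglyMeasurable (fun s => f (ζ s) (v s)) (volume.restrict (Ioc a b)) := by
    refine aestronglyMeasurable_of_tendsto_ae Filter.atTop hg ?_
    filter_upwards [ae_restrict_mem measurableSet_Ioc] with s hs
    rw [tendsto_iff_norm_sub_tendsto_zero]
    exact squeeze_zero (fun _ => norm_nonneg _) (fun k => hgε k s hs)
      tendsto_one_div_add_atTop_nhds_zero_nat
  refine Integrable.mono' (g := fun _ => M) (integrableOn_const (by simp)) hmeas ?_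
  filter_upwards [ae_restrict_mem measurableSet_Ioc] with s hs
  exact hMb _ _ (((hK s (Ioc_subset_Icc_self hs)).trans (by linarith)).trans
    (le_max_left (K + 1) R)) ((hv.norm_le s).trans (by simp))

end IsForwardCompleteSystem

end Systems

/-! ### Exact solutions near approximate ones -/

section Systems

variable {E V : Type*} [NormedAddCommGroup E] [NormedSpace ℝ E] [NormedAddCommGroup V]
  [MeasurableSpace V] {f : E → V → E} {v : ℝ → V} {R T : ℝ}

/-- An approximate solution `χ` on `[0, T]` is shadowed by an exact solution which ends at the same
point. The distance is measured with a weight `η` which absorbs the Lipschitz constants `ℓ`. The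
equation is solved backwards from time `T` as the fixed point of
`ζ ↦ (t ↦ χ(T) - ∫ₜᵀ f(ζ, v))`, which is a contraction for the weighted distance. -/
theorem IsForwardCompleteSystem.exists_solution_near [CompleteSpace E]
    (hf : IsForwardCompleteSystem f) (hT : 0 ≤ T) (hv : IsInput v R) {χ : ℝ → E}
    (hχ : ContinuousOn χ (Icc 0 T)) {η ℓ : ℝ → ℝ} (hη : ContinuousOn η (Icc 0 T))
    (hη0 : ∀ s ∈ Icc 0 T, 0 < η s) (hℓ : ContinuousOn ℓ (Icc 0 T))
    (hℓ0 : ∀ s ∈ Icc 0 T, 0 ≤ ℓ s)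
    (hLip : ∀ s ∈ Icc 0 T, ∀ x y, ‖x - χ s‖ ≤ η s → ‖y - χ s‖ ≤ η s →
      ‖f x (v s) - f y (v s)‖ ≤ ℓ s * ‖x - y‖)
    (hw : ∀ t ∈ Icc 0 T, ∫ s in t..T, ℓ s * η s ≤ η t / 2)
    (hd : ∀ t ∈ Icc 0 T, ‖(∫ s in t..T, f (χ s) (v s)) - (χ T - χ t)‖ ≤ η t / 2) :
    ∃ ζ, IsSolutionOn f v 0 T ζ ∧ ∀ t ∈ Icc 0 T, ‖ζ t - χ t‖ ≤ η t := by
  set e : C(Icc 0 T, E) → ℝ → E := fun g s => χ s + η s • g (projIcc 0 T hT s) with he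
  have hec : ∀ g, ContinuousOn (e g) (Icc 0 T) := fun g =>
    hχ.add (hη.smul (g.continuous.comp continuous_projIcc).continuousOn)
  have hei : ∀ g, ∀ t ∈ Icc 0 T, IntervalIntegrable (fun s => f (e g s) (v s)) volume t T :=
    fun g t ht => hf.intervalIntegrable_comp hv ht.2 ((hec g).mono (Icc_subset_Icc_left ht.1))
  have hℓη : ∀ t ∈ Icc 0 T, IntervalIntegrable (fun s => ℓ s * η s) volume t T := fun t ht =>
    ((hℓ.mul hη).mono (by
      rw [uIcc_of_le ht.2]; exact Icc_subset_Icc_left ht.1)).intervalIntegrable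
  set Z : C(Icc 0 T, E) → ℝ → E := fun g t => χ T - ∫ s in t..T, f (e g s) (v s) with hZ
  have hZc : ∀ g, ContinuousOn (Z g) (Icc 0 T) := fun g => by
    refine continuousOn_const.sub ?_
    have := intervalIntegral.continuousOn_primitive_interval_left (μ := volume)
      (f := fun s => f (e g s) (v s)) (a := 0) (b := T) ?_
    · rwa [uIcc_of_le hT] at this
    · rw [uIcc_of_le hT, integrableOn_Icc_iff_integrableOn_Ioc]
      exact (intervalIntegrable_iff_integrableOn_Ioc_of_le hT).1 (hei g 0 ⟨le_rfl, hT⟩)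
  set Φ : C(Icc 0 T, E) → C(Icc 0 T, E) := fun g =>
    ⟨fun t => (η t)⁻¹ • (Z g t - χ t), by
      have h1 : ContinuousOn (fun t => (η t)⁻¹ • (Z g t - χ t)) (Icc 0 T) :=
        (hη.inv₀ fun s hs => (hη0 s hs).ne').smul ((hZc g).sub hχ)
      exact continuousOn_iff_continuous_domRestrict.1 h1⟩ with hΦ
  have hdiff : ∀ g₁ g₂ : C(Icc 0 T, E), ‖g₁‖ ≤ 1 → ‖g₂‖ ≤ 1 → ∀ t ∈ Icc 0 T,
      ‖Z g₁ t - Z g₂ t‖ ≤ η t / 2 * ‖g₁ - g₂‖ := by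
    intro g₁ g₂ h₁ h₂ t ht
    have h3 : Z g₁ t - Z g₂ t = -∫ s in t..T, (f (e g₁ s) (v s) - f (e g₂ s) (v s)) := by
      rw [intervalIntegral.integral_sub (hei g₁ t ht) (hei g₂ t ht)]
      simp only [hZ]; abel
    rw [h3, norm_neg]
    have h4 : ∀ s ∈ Ioc t T, ‖f (e g₁ s) (v s) - f (e g₂ s) (v s)‖ ≤
        ℓ s * η s * ‖g₁ - g₂‖ := by
      intro s hs
      have hs' : s ∈ Icc 0 T := ⟨ht.1.trans hs.1.le, hs.2⟩
      have aux : ∀ g : C(Icc 0 T, E), ‖g‖ ≤ 1 → ‖e g s - χ s‖ ≤ η s := fun g hg => by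
        simp only [he, add_sub_cancel_left, norm_smul, Real.norm_of_nonneg (hη0 s hs').le]
        exact mul_le_of_le_one_right (hη0 s hs').le ((g.norm_coe_le_norm _).trans hg)
      have hsub : e g₁ s - e g₂ s = η s • ((g₁ - g₂) (projIcc 0 T hT s)) := by
        simp only [he, ContinuousMap.sub_apply, smul_sub]; abel
      refine (hLip s hs' _ _ (aux g₁ h₁) (aux g₂ h₂)).trans ?_
      rw [hsub, norm_smul, Real.norm_of_nonneg (hη0 s hs').le, ← mul_assoc]
      exact mul_le_mul_of_nonneg_left ((g₁ - g₂).norm_coe_le_norm _)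
        (mul_nonneg (hℓ0 s hs') (hη0 s hs').le)
    refine (intervalIntegral.norm_integral_le_of_norm_le ht.2
      (Filter.Eventually.of_forall h4) ((hℓη t ht).mul_const _)).trans ?_
    rw [intervalIntegral.integral_mul_const]
    exact mul_le_mul_of_nonneg_right (hw t ht) (norm_nonneg _)
  have hΦd : ∀ g₁ g₂ : C(Icc 0 T, E), ‖g₁‖ ≤ 1 → ‖g₂‖ ≤ 1 →
      ‖Φ g₁ - Φ g₂‖ ≤ 1 / 2 * ‖g₁ - g₂‖ := by
    intro g₁ g₂ h₁ h₂
    rw [ContinuousMap.norm_le _ (by positivity)]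
    intro t
    have ht := hη0 t t.2
    have : (Φ g₁ - Φ g₂) t = (η t)⁻¹ • (Z g₁ t - Z g₂ t) := by
      change (η t)⁻¹ • (Z g₁ t - χ t) - (η t)⁻¹ • (Z g₂ t - χ t) = _
      rw [← smul_sub, sub_sub_sub_cancel_right]
    rw [this, norm_smul, norm_inv, Real.norm_of_nonneg ht.le, inv_mul_le_iff₀ ht]
    refine (hdiff g₁ g₂ h₁ h₂ t t.2).trans (le_of_eq ?_)
    ring
  have hΦ0 : ‖Φ 0‖ ≤ 1 / 2 := by
    rw [ContinuousMap.norm_le _ (by positivity)]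
    intro t
    have ht := hη0 t t.2
    have he0 : e 0 = χ := by funext s; simp [he]
    have : Φ 0 t = -(η t)⁻¹ • ((∫ s in t..T, f (χ s) (v s)) - (χ T - χ t)) := by
      simp only [hΦ, ContinuousMap.coe_mk, hZ, he0, neg_smul, ← smul_neg]
      congr 1; abel
    rw [this, norm_smul, norm_neg, norm_inv, Real.norm_of_nonneg ht.le, inv_mul_le_iff₀ ht]
    refine (hd t t.2).trans (le_of_eq ?_)
    ring
  have hmaps : MapsTo Φ (Metric.closedBall 0 1) (Metric.closedBall 0 1) := by
    intro g hg
    rw [mem_closedBall_zero_iff] at hg ⊢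
    have h1 := hΦd g 0 hg (by simp)
    rw [sub_zero] at h1
    have h2 := norm_le_norm_add_norm_sub' (Φ g) (Φ 0)
    linarith
  have hcontr : ContractingWith (1 / 2) (hmaps.restrict Φ _ _) := by
    refine ⟨by rw [← NNReal.coe_lt_coe]; norm_num, LipschitzWith.of_dist_le_mul fun g₁ g₂ => ?_⟩
    rw [Subtype.dist_eq, Subtype.dist_eq, dist_eq_norm, dist_eq_norm]
    have := hΦd g₁ g₂ (mem_closedBall_zero_iff.1 g₁.2) (mem_closedBall_zero_iff.1 g₂.2)
    simpa using this
  obtain ⟨g, hg, hfix, -⟩ := hcontr.exists_fixedPoint' Metric.isClosed_closedBall.isComplete hmaps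
    (x := 0) (by simp) (edist_ne_top _ _)
  have hgn : ‖g‖ ≤ 1 := mem_closedBall_zero_iff.1 hg
  have heZ : ∀ t ∈ Icc 0 T, e g t = Z g t := by
    intro t ht
    have h1 : g ⟨t, ht⟩ = (η t)⁻¹ • (Z g t - χ t) := by
      conv_lhs => rw [← hfix.eq]
      rfl
    simp only [he]
    rw [projIcc_of_mem hT ht, h1, smul_smul, mul_inv_cancel₀ (hη0 t ht).ne', one_smul]
    abel
  refine ⟨e g, ⟨hec g, hei g 0 ⟨le_rfl, hT⟩, fun t ht => ?_⟩, fun t ht => ?_⟩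
  · rw [heZ t ht, heZ 0 ⟨le_rfl, hT⟩]
    simp only [hZ]
    have := intervalIntegral.integral_add_adjacent_intervals
      ((hei g 0 ⟨le_rfl, hT⟩).trans (hei g t ht).symm) (hei g t ht)
    rw [← this]
    abel
  · simp only [he, add_sub_cancel_left, norm_smul, Real.norm_of_nonneg (hη0 t ht).le]
    exact mul_le_of_le_one_right (hη0 t ht).le ((g.norm_coe_le_norm _).trans hgn)

end Systems

/-! ### Shadowing limits of solutions by solutions -/

/-- The exponential weight `η = κ e^{-2Λ}`, where `Λ` is the primitive of `ℓ`, absorbs `ℓ`. -/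
theorem integral_mul_exp_weight_le {ℓ κ : ℝ → ℝ} {T : ℝ} (hℓ : ContinuousOn ℓ (Icc 0 T))
    (hℓ0 : ∀ s ∈ Icc 0 T, 0 ≤ ℓ s) (hκ : Continuous κ) (hκa : Antitone κ) {t : ℝ}
    (hκ0 : ∀ s, 0 < κ s) (ht : t ∈ Icc 0 T) :
    ContinuousOn (fun s => κ s * Real.exp (-2 * ∫ q in (0 : ℝ)..s, ℓ q)) (Icc 0 T) ∧
    ∫ s in t..T, ℓ s * (κ s * Real.exp (-2 * ∫ q in (0 : ℝ)..s, ℓ q)) ≤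
      κ t * Real.exp (-2 * ∫ q in (0 : ℝ)..t, ℓ q) / 2 := by
  have hT : 0 ≤ T := ht.1.trans ht.2
  set Λ : ℝ → ℝ := fun s => ∫ q in (0 : ℝ)..s, ℓ q with hΛ
  have hΛc : ContinuousOn Λ (Icc 0 T) := by
    have := intervalIntegral.continuousOn_primitive_interval (μ := volume) (f := ℓ) (a := 0)
      (b := T) (by rw [uIcc_of_le hT]; exact hℓ.integrableOn_Icc)
    rwa [uIcc_of_le hT] at this
  have hec : ContinuousOn (fun s => Real.exp (-2 * Λ s)) (Icc 0 T) :=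
    (continuousOn_const.mul hΛc).rexp
  have hsub : Icc t T ⊆ Icc 0 T := Icc_subset_Icc_left ht.1
  refine ⟨hκ.continuousOn.mul hec, ?_⟩
  have hint : ContinuousOn (fun s => ℓ s * Real.exp (-2 * Λ s)) (Icc t T) :=
    (hℓ.mul hec).mono hsub
  have hderiv : ∀ s ∈ Ioo t T, HasDerivAt (fun s => -(1 / 2) * Real.exp (-2 * Λ s))
      (ℓ s * Real.exp (-2 * Λ s)) s := by
    intro s hs
    have hs0 : 0 ≤ s := ht.1.trans hs.1.le
    have hs' : Icc 0 T ∈ nhds s := Icc_mem_nhds (ht.1.trans_lt hs.1) hs.2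
    have h1 : HasDerivAt Λ (ℓ s) s := by
      refine intervalIntegral.integral_hasDerivAt_right ?_ ?_ (hℓ.continuousAt hs')
      · exact (hℓ.mono (by
          rw [uIcc_of_le hs0]; exact Icc_subset_Icc_right hs.2.le)).intervalIntegrable
      · exact ⟨Icc 0 T, hs', hℓ.aestronglyMeasurable measurableSet_Icc⟩
    have h2 := ((h1.const_mul (-2)).exp).const_mul (-(1 / 2))
    exact h2.congr_deriv (by ring)
  have hFTC := intervalIntegral.integral_eq_sub_of_hasDerivAt_of_le ht.2
    ((continuousOn_const.mul hec).mono hsub) hderiv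
    (hint.mono (by rw [uIcc_of_le ht.2])).intervalIntegrable
  calc ∫ s in t..T, ℓ s * (κ s * Real.exp (-2 * Λ s))
      ≤ ∫ s in t..T, κ t * (ℓ s * Real.exp (-2 * Λ s)) := by
        refine intervalIntegral.integral_mono_on ht.2 ?_ ?_ fun s hs => ?_
        · exact (((hℓ.mul (hκ.continuousOn.mul hec)).mono hsub).mono
            (by rw [uIcc_of_le ht.2])).intervalIntegrable
        · exact ((continuousOn_const.mul hint).mono (by rw [uIcc_of_le ht.2])).intervalIntegrable
        · have h1 := hκa hs.1
          have h2 := mul_nonneg (hℓ0 s (hsub hs)) (Real.exp_pos (-2 * Λ s)).le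
          nlinarith
    _ = κ t * (-(1 / 2) * Real.exp (-2 * Λ T) - -(1 / 2) * Real.exp (-2 * Λ t)) := by
        rw [intervalIntegral.integral_const_mul, hFTC]
        rfl
    _ ≤ κ t * Real.exp (-2 * Λ t) / 2 := by
        have := mul_pos (hκ0 t) (Real.exp_pos (-2 * Λ T))
        linarith

section Systems

variable {E V : Type*} [NormedAddCommGroup E] [NormedSpace ℝ E] [NormedAddCommGroup V]
  [MeasurableSpace V] {f : E → V → E} {R : ℝ}

omit [NormedSpace ℝ E] in
/-- Concatenation of inputs along an increasing sequence of times. -/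
theorem exists_isInput_concat {u : ℕ → ℝ → V} (hu : ∀ j, IsInput (u j) R) {t : ℕ → ℝ}
    (ht : StrictMono t) :
    ∃ w, IsInput w R ∧ ∀ j, ∀ s ∈ Ioc (t j) (t (j + 1)), u j s = w s := by
  classical
  -- the second alternative only serves to define the input after all times `t i`
  set p : ℝ → ℕ → Prop := fun s k => s ≤ t (k + 1) ∨ ∀ i, t i < s with hp
  have hex : ∀ s, ∃ k, p s k := fun s => by
    by_cases h : ∃ k, s ≤ t (k + 1)
    · exact h.imp fun k hk => Or.inl hk
    · push Not at h
      exact ⟨0, Or.inr fun i => (ht (Nat.lt_succ_self i)).trans (h i)⟩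
  have hmeas : Measurable fun s => Nat.find (hex s) := by
    refine measurable_find hex fun k => ?_
    have hset : {s | p s k} = Iic (t (k + 1)) ∪ ⋂ i, Ioi (t i) := by
      ext; simp [hp]
    rw [hset]
    exact measurableSet_Iic.union (MeasurableSet.iInter fun i => measurableSet_Ioi)
  refine ⟨fun s => u (Nat.find (hex s)) s, ⟨?_, fun s => (hu _).norm_le s⟩, fun j s hs => ?_⟩
  · have h1 : Measurable fun q : ℝ × ℕ => u q.2 q.1 :=
      measurable_from_prod_countable_left fun j => (hu j).measurable
    exact h1.comp (measurable_id.prodMk hmeas)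
  · have : Nat.find (hex s) = j := by
      rw [Nat.find_eq_iff]
      refine ⟨Or.inl hs.2, fun k hk h => ?_⟩
      rcases h with h | h
      · exact absurd (h.trans (ht.monotone hk)) (not_le.2 hs.1)
      · exact absurd hs.2 (not_le.2 (h _))
    simp only [this]

omit [NormedAddCommGroup V] [MeasurableSpace V] in
/-- How far a curve uniformly close to a solution is from solving the equation itself. -/
theorem IsSolutionOn.defect_le {u : ℝ → V} {ξ χ : ℝ → E} {a b A d : ℝ} (hab : a ≤ b)
    (h : IsSolutionOn f u a b ξ) (hχ : IntervalIntegrable (fun s => f (χ s) (u s)) volume a b)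
    (hA : 0 ≤ A) (hd : ∀ s ∈ Icc a b, ‖ξ s - χ s‖ ≤ d)
    (hLip : ∀ s ∈ Icc a b, ‖f (ξ s) (u s) - f (χ s) (u s)‖ ≤ A * ‖ξ s - χ s‖) :
    ‖(∫ s in a..b, f (χ s) (u s)) - (χ b - χ a)‖ ≤ (A * (b - a) + 2) * d := by
  have hb : b ∈ Icc a b := ⟨hab, le_rfl⟩
  have ha : a ∈ Icc a b := ⟨le_rfl, hab⟩
  have h1 : (∫ s in a..b, f (χ s) (u s)) - (χ b - χ a) =
      -(∫ s in a..b, (f (ξ s) (u s) - f (χ s) (u s))) + (ξ b - χ b) - (ξ a - χ a) := by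
    rw [intervalIntegral.integral_sub h.2.1 hχ, h.2.2 b hb]
    abel
  have h2 : ‖∫ s in a..b, (f (ξ s) (u s) - f (χ s) (u s))‖ ≤ A * d * |b - a| := by
    refine intervalIntegral.norm_integral_le_of_norm_le_const fun s hs => ?_
    rw [uIoc_of_le hab] at hs
    have hs' := Ioc_subset_Icc_self hs
    exact (hLip s hs').trans (by gcongr; exact hd s hs')
  rw [abs_of_nonneg (by linarith)] at h2
  rw [h1]
  refine (_root_.norm_sub_le _ _).trans ((add_le_add (norm_add_le _ _) le_rfl).trans ?_)
  rw [norm_neg]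
  linarith [hd b hb, hd a ha]

namespace IsForwardCompleteSystem

variable (hf : IsForwardCompleteSystem f)
include hf

theorem exists_continuous_lipschitz_constant : ∃ L : C(ℝ, ℝ), ∀ r, 0 < L r ∧ ∀ x₁ x₂ : E, ∀ v : V,
    ‖x₁‖ ≤ r → ‖x₂‖ ≤ r → ‖v‖ ≤ r → ‖f x₁ v - f x₂ v‖ ≤ L r * ‖x₁ - x₂‖ := by
  refine exists_continuous_forall_mem_convex_of_local_const
    (t := fun r => {L : ℝ | 0 < L ∧ ∀ x₁ x₂ : E, ∀ v : V,
      ‖x₁‖ ≤ r → ‖x₂‖ ≤ r → ‖v‖ ≤ r → ‖f x₁ v - f x₂ v‖ ≤ L * ‖x₁ - x₂‖}) (fun r => ?_) fun r => ?_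
  · refine OrdConnected.convex ⟨fun L hL M _ N hN => ⟨hL.1.trans_le hN.1, ?_⟩⟩
    intro x₁ x₂ v h₁ h₂ hv
    exact (hL.2 x₁ x₂ v h₁ h₂ hv).trans (by gcongr; exact hN.1)
  · obtain ⟨L, hL, hLip⟩ := hf.lipschitz (r + 1)
    refine ⟨L, ?_⟩
    filter_upwards [gt_mem_nhds (lt_add_one r)] with q hq
    exact ⟨hL, fun x₁ x₂ v h₁ h₂ hv => hLip x₁ x₂ v (h₁.trans hq.le) (h₂.trans hq.le)
      (hv.trans hq.le)⟩

/-- Suppose that solutions `ξ k` with inputs bounded by `R` converge, uniformly on each of the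
intervals `[0, t j]`, to a curve `χ`. In general `χ` is not a solution (it solves a relaxed
equation), but some solution with input bounded by `R` stays as close to `χ` as desired on the whole
of `⋃ j, [0, t j]`.

The input follows `u (k j)` between `t j` and `t (j + 1)`. Errors are propagated *backwards* in
time: those made after time `t j` can be chosen so small, depending on what happened before, that
their effect on earlier times is negligible. The initial state is not prescribed. -/
theorem exists_shadowing [ProperSpace E] {ι : Type*} {l : Filter ι} [l.NeBot] {u : ι → ℝ → V}
    {ξ : ι → ℝ → E} (hu : ∀ᶠ k in l, IsInput (u k) R)
    (hξ : ∀ k T, 0 ≤ T → IsSolutionOn f (u k) 0 T (ξ k)) {t : ℕ → ℝ} (ht0 : t 0 = 0)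
    (ht : StrictMono t) {χ : ℝ → E}
    (hχ : ∀ j, ∀ d > 0, ∀ᶠ k in l, ∀ s ∈ Icc 0 (t j), ‖ξ k s - χ s‖ ≤ d)
    {κ : ℝ → ℝ} (hκ : Continuous κ) (hκa : Antitone κ) (hκ0 : ∀ s, 0 < κ s) (hκ1 : ∀ s, κ s ≤ 1) :
    ∃ w ζ, IsInput w R ∧ (∀ T, 0 ≤ T → IsSolutionOn f w 0 T ζ) ∧
      ∀ j, ∀ s ∈ Icc 0 (t j), ‖ζ s - χ s‖ ≤ κ s := by
  have htn : ∀ j, 0 ≤ t j := fun j => by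
    rw [← ht0]; exact ht.monotone (Nat.zero_le j)
  have hχc : ∀ j, ContinuousOn χ (Icc 0 (t j)) := by
    intro j
    have hlim : TendstoUniformlyOn ξ χ l (Icc 0 (t j)) := by
      rw [Metric.tendstoUniformlyOn_iff]
      intro ε hε
      filter_upwards [hχ j (ε / 2) (half_pos hε)] with k hk s hs
      rw [dist_comm, dist_eq_norm]
      exact (hk s hs).trans_lt (half_lt_self hε)
    exact hlim.continuousOn (Filter.Eventually.of_forall fun k => (hξ k _ (htn j)).1).frequently
  obtain ⟨Lc, hLc⟩ := hf.exists_continuous_lipschitz_constant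
  set ℓ : ℝ → ℝ := fun s => Lc (‖χ s‖ + 1 + |R|) with hℓdef
  have hℓc : ∀ j, ContinuousOn ℓ (Icc 0 (t j)) := fun j =>
    Lc.continuous.comp_continuousOn (((hχc j).norm.add continuousOn_const).add continuousOn_const)
  have hℓ0 : ∀ s, 0 ≤ ℓ s := fun s => (hLc _).1.le
  have hLip : ∀ s x y v, ‖x - χ s‖ ≤ 1 → ‖y - χ s‖ ≤ 1 → ‖v‖ ≤ R →
      ‖f x v - f y v‖ ≤ ℓ s * ‖x - y‖ := by
    intro s x y v hx hy hv
    have aux : ∀ z : E, ‖z - χ s‖ ≤ 1 → ‖z‖ ≤ ‖χ s‖ + 1 + |R| := fun z hz => by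
      have := norm_le_norm_add_norm_sub' z (χ s)
      linarith [abs_nonneg R]
    exact (hLc _).2 x y v (aux x hx) (aux y hy) (by
      linarith [le_abs_self R, norm_nonneg (χ s)])
  set η : ℝ → ℝ := fun s => κ s * Real.exp (-2 * ∫ q in (0 : ℝ)..s, ℓ q) with hηdef
  have hη0 : ∀ s, 0 < η s := fun s => mul_pos (hκ0 s) (Real.exp_pos _)
  have hΛmono : ∀ j, ∀ s ∈ Icc 0 (t j), ∀ s' ∈ Icc 0 (t j), s ≤ s' →
      ∫ q in (0 : ℝ)..s, ℓ q ≤ ∫ q in (0 : ℝ)..s', ℓ q := by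
    intro j s hs s' hs' hss
    refine intervalIntegral.integral_mono_interval le_rfl hs.1 hss
      (Filter.Eventually.of_forall hℓ0) ((hℓc j).mono ?_).intervalIntegrable
    rw [uIcc_of_le hs'.1]
    exact Icc_subset_Icc_right hs'.2
  have hηκ : ∀ s, 0 ≤ s → η s ≤ κ s := by
    intro s hs
    refine mul_le_of_le_one_right (hκ0 s).le (Real.exp_le_one_iff.2 ?_)
    have : 0 ≤ ∫ q in (0 : ℝ)..s, ℓ q := intervalIntegral.integral_nonneg hs fun q _ => hℓ0 q
    linarith
  have hηanti : ∀ j, ∀ s ∈ Icc 0 (t j), ∀ s' ∈ Icc 0 (t j), s ≤ s' → η s' ≤ η s := by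
    intro j s hs s' hs' hss
    refine mul_le_mul (hκa hss) (Real.exp_le_exp.2 ?_) (Real.exp_pos _).le (hκ0 s).le
    linarith [hΛmono j s hs s' hs' hss]
  -- choice of the pieces
  have hA : ∀ j, ∃ A, 0 ≤ A ∧ ∀ s ∈ Icc 0 (t (j + 1)), ℓ s ≤ A := fun j => by
    obtain ⟨A, hA⟩ := isCompact_Icc.exists_bound_of_continuousOn (hℓc (j + 1))
    exact ⟨A, (norm_nonneg _).trans (hA 0 ⟨le_rfl, htn _⟩),
      fun s hs => (le_abs_self _).trans (hA s hs)⟩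
  choose A hA0 hA using hA
  have htj : ∀ j, 0 ≤ t (j + 1) - t j := fun j => sub_nonneg.2 (ht (Nat.lt_succ_self j)).le
  have hden : ∀ j, 0 < A j * (t (j + 1) - t j) + 2 := fun j => by
    have := mul_nonneg (hA0 j) (htj j); linarith
  -- closeness required on the piece `j`: its defect is then at most `η(t (j + 1)) / 2 ^ (j + 2)`,
  -- and these defects sum up to at most `η / 2`
  set d : ℕ → ℝ := fun j =>
    min 1 (η (t (j + 1)) * (1 / 2) ^ (j + 2) / (A j * (t (j + 1) - t j) + 2)) with hd
  have hd0 : ∀ j, 0 < d j := fun j =>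
    lt_min one_pos (div_pos (mul_pos (hη0 _) (by positivity)) (hden j))
  choose k hk using fun j => (hu.and (hχ (j + 1) (d j) (hd0 j))).exists
  obtain ⟨w, hw, hwu⟩ := exists_isInput_concat (fun j => (hk j).1) ht
  have hint : ∀ j, ∀ a ∈ Icc 0 (t j), ∀ b ∈ Icc 0 (t j), a ≤ b →
      IntervalIntegrable (fun s => f (χ s) (w s)) volume a b := fun j a ha b hb hab =>
    hf.intervalIntegrable_comp hw hab ((hχc j).mono (Icc_subset_Icc ha.1 hb.2))
  -- defect of `χ` on a single piece
  have hpiece : ∀ j, ∀ s ∈ Icc (t j) (t (j + 1)),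
      ‖(∫ q in s..t (j + 1), f (χ q) (w q)) - (χ (t (j + 1)) - χ s)‖ ≤
        η (t (j + 1)) * (1 / 2) ^ (j + 2) := by
    intro j s hs
    have hsub : Icc s (t (j + 1)) ⊆ Icc 0 (t (j + 1)) :=
      Icc_subset_Icc_left ((htn j).trans hs.1)
    have hsol := (hξ (k j) _ (htn (j + 1))).mono ((htn j).trans hs.1) hs.2 le_rfl
    have hcongr : ∫ q in s..t (j + 1), f (χ q) (w q) =
        ∫ q in s..t (j + 1), f (χ q) (u (k j) q) := by
      refine intervalIntegral.integral_congr_ae (Filter.Eventually.of_forall fun q hq => ?_)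
      rw [uIoc_of_le hs.2] at hq
      rw [hwu j q ⟨hs.1.trans_lt hq.1, hq.2⟩]
    rw [hcongr]
    refine (hsol.defect_le hs.2
      (hf.intervalIntegrable_comp (hk j).1 hs.2 ((hχc (j + 1)).mono hsub)) (hA0 j)
      (fun q hq => (hk j).2 q (hsub hq)) fun q hq => ?_).trans ?_
    · refine (hLip q _ _ _ (((hk j).2 q (hsub hq)).trans (min_le_left _ _)) (by simp)
        ((hk j).1.norm_le q)).trans ?_
      gcongr
      exact hA j q (hsub hq)
    · have h1 : d j ≤ η (t (j + 1)) * (1 / 2) ^ (j + 2) / (A j * (t (j + 1) - t j) + 2) :=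
        min_le_right _ _
      rw [le_div_iff₀ (hden j)] at h1
      refine le_trans ?_ h1
      rw [mul_comm]
      refine mul_le_mul_of_nonneg_left ?_ (hd0 j).le
      have := mul_le_mul_of_nonneg_left (sub_le_sub_left hs.1 (t (j + 1))) (hA0 j)
      linarith
  -- defect of `χ` on `[s, t J]`
  have hdefect : ∀ J, ∀ s ∈ Icc 0 (t J),
      ‖(∫ q in s..t J, f (χ q) (w q)) - (χ (t J) - χ s)‖ ≤
        η s * (1 / 2 - (1 / 2) ^ (J + 1)) := by
    intro J
    induction J with
    | zero =>
      intro s hs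
      rw [ht0] at hs
      obtain rfl : s = 0 := le_antisymm hs.2 hs.1
      simp [ht0]
    | succ J ih =>
      intro s hs
      have hJ1 : t J ≤ t (J + 1) := (ht (Nat.lt_succ_self J)).le
      have hJm : t J ∈ Icc 0 (t (J + 1)) := ⟨htn J, hJ1⟩
      have hJ1m : t (J + 1) ∈ Icc 0 (t (J + 1)) := ⟨htn _, le_rfl⟩
      have hηs := hηanti (J + 1) s hs _ hJ1m hs.2
      have hpow : (0 : ℝ) ≤ (1 / 2) ^ (J + 2) := by positivity
      rcases le_total s (t J) with h | h
      · have h1 := ih s ⟨hs.1, h⟩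
        have h2 := hpiece J (t J) ⟨le_rfl, hJ1⟩
        have h3 := intervalIntegral.integral_add_adjacent_intervals
          (hint (J + 1) s hs (t J) hJm h) (hint (J + 1) _ hJm _ hJ1m hJ1)
        have h4 : (∫ q in s..t (J + 1), f (χ q) (w q)) - (χ (t (J + 1)) - χ s) =
            ((∫ q in s..t J, f (χ q) (w q)) - (χ (t J) - χ s)) +
            ((∫ q in t J..t (J + 1), f (χ q) (w q)) - (χ (t (J + 1)) - χ (t J))) := by
          rw [← h3]; abel
        rw [h4]
        refine (norm_add_le _ _).trans ((add_le_add h1 h2).trans ?_)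
        have h5 := mul_le_mul_of_nonneg_right hηs hpow
        have h6 : ((1 : ℝ) / 2) ^ (J + 1) = 2 * (1 / 2) ^ (J + 2) := by ring
        have h7 : ((1 : ℝ) / 2) ^ (J + 1 + 1) = (1 / 2) ^ (J + 2) := rfl
        rw [h6, h7]
        linarith
      · refine (hpiece J s ⟨h, hs.2⟩).trans ?_
        refine mul_le_mul hηs ?_ hpow (hη0 s).le
        have h7 : ((1 : ℝ) / 2) ^ (J + 1 + 1) = (1 / 2) ^ (J + 2) := rfl
        have h8 : ((1 : ℝ) / 2) ^ (J + 2) ≤ 1 / 4 := by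
          have : ((1 : ℝ) / 2) ^ J ≤ 1 := pow_le_one₀ (by norm_num) (by norm_num)
          rw [pow_add]; linarith
        rw [h7]; linarith
  -- solutions shadowing `χ` on `[0, t J]`
  have hsolJ : ∀ J, ∃ ζ, IsSolutionOn f w 0 (t J) ζ ∧ ∀ s ∈ Icc 0 (t J), ‖ζ s - χ s‖ ≤ η s := by
    intro J
    have hη1 : ∀ s ∈ Icc 0 (t J), η s ≤ 1 := fun s hs => (hηκ s hs.1).trans (hκ1 s)
    refine hf.exists_solution_near (htn J) hw (hχc J) (ℓ := ℓ)
      (integral_mul_exp_weight_le (hℓc J) (fun s _ => hℓ0 s) hκ hκa hκ0 ⟨htn J, le_rfl⟩).1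
      (fun s _ => hη0 s) (hℓc J) (fun s _ => hℓ0 s)
      (fun s hs x y hx hy => hLip s x y _ (hx.trans (hη1 s hs)) (hy.trans (hη1 s hs))
        (hw.norm_le s))
      (fun s hs => (integral_mul_exp_weight_le (hℓc J) (fun s _ => hℓ0 s) hκ hκa hκ0 hs).2)
      (fun s hs => (hdefect J s hs).trans ?_)
    have h1 := mul_pos (hη0 s) (show (0 : ℝ) < (1 / 2) ^ (J + 1) by positivity)
    linarith
  choose ζ hζ hζη using hsolJ
  -- passage to the limit in the initial states
  have hq : ∀ J, ζ J 0 ∈ Metric.closedBall (χ 0) 1 := fun J => by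
    rw [mem_closedBall_iff_norm]
    exact (hζη J 0 ⟨le_rfl, htn J⟩).trans ((hηκ 0 le_rfl).trans (hκ1 0))
  obtain ⟨q, -, φ, hφ, hφq⟩ := (isCompact_closedBall (χ 0) 1).tendsto_subseq hq
  obtain ⟨z, hz0, hz⟩ := hf.exists_solution w R hw q
  refine ⟨w, z, hw, hz, fun j s hs => ?_⟩
  have hzj := hz (t j) (htn j)
  obtain ⟨B, hB⟩ := isCompact_Icc.exists_bound_of_continuousOn hzj.1
  obtain ⟨B', hB'⟩ := isCompact_Icc.exists_bound_of_continuousOn (hχc j)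
  obtain ⟨L, hL, hLipL⟩ := hf.lipschitz (max (max B (B' + 1)) R)
  have hclose : ∀ i, j ≤ i →
      ‖z s - χ s‖ ≤ ‖q - ζ (φ i) 0‖ * Real.exp (L * (s - 0)) + η s := by
    intro i hi
    have hji : t j ≤ t (φ i) := ht.monotone (hi.trans (hφ.id_le i))
    have h1 := (hζ (φ i)).mono le_rfl (htn j) hji
    have hsub : Icc 0 (t j) ⊆ Icc 0 (t (φ i)) := Icc_subset_Icc_right hji
    have h2 := hzj.norm_sub_le_exp h1 hL (fun p hp => hLipL _ _ _
      ((hB p hp).trans (by simp)) ?_ ((hw.norm_le p).trans (by simp))) hs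
    · rw [hz0] at h2
      have h3 := hζη (φ i) s (hsub hs)
      have h4 : z s - χ s = (z s - ζ (φ i) s) + (ζ (φ i) s - χ s) := by abel
      rw [h4]
      exact (norm_add_le _ _).trans (add_le_add h2 h3)
    · have h5 := (hζη (φ i) p (hsub hp)).trans ((hηκ p hp.1).trans (hκ1 p))
      have h6 := norm_le_norm_add_norm_sub' (ζ (φ i) p) (χ p)
      have h7 := hB' p hp
      exact le_max_of_le_left (le_max_of_le_right (by linarith))
  have hlim : Filter.Tendsto (fun i => ‖q - ζ (φ i) 0‖ * Real.exp (L * (s - 0)) + η s)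
      Filter.atTop (nhds (0 * Real.exp (L * (s - 0)) + η s)) := by
    refine Filter.Tendsto.add_const _ (Filter.Tendsto.mul_const _ ?_)
    have := (tendsto_iff_norm_sub_tendsto_zero.1 hφq)
    refine this.congr fun i => ?_
    rw [norm_sub_rev]; rfl
  have := ge_of_tendsto hlim (Filter.eventually_atTop.2 ⟨j, hclose⟩)
  rw [zero_mul, zero_add] at this
  exact this.trans (hηκ s hs.1)

end IsForwardCompleteSystem

end Systems

/-! ### Limit curves, bounded reachability sets and uniform attainability -/

/-- A sequence of positive numbers has a continuous antitone positive minorant. -/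
theorem exists_continuous_antitone_minorant {ε : ℕ → ℝ} (hε : ∀ i, 0 < ε i) :
    ∃ κ : ℝ → ℝ, Continuous κ ∧ Antitone κ ∧ (∀ s, 0 < κ s) ∧ (∀ s, κ s ≤ 1) ∧
      ∀ (i : ℕ) (s : ℝ), i ≤ s → κ s ≤ ε i := by
  set q : ℝ → ℕ → ℝ := fun s i => min 1 (ε i + max 0 (i - s)) with hq
  have hq0 : ∀ s i, 0 ≤ q s i := fun s i =>
    le_min zero_le_one (add_nonneg (hε i).le (le_max_left _ _))
  have hbdd : ∀ s, BddBelow (range (q s)) := fun s => ⟨0, by rintro _ ⟨i, rfl⟩; exact hq0 s i⟩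
  refine ⟨fun s => ⨅ i, q s i, ?_, ?_, ?_, ?_, ?_⟩
  · refine (LipschitzWith.of_le_add fun s s' => ?_).continuous
    rw [← sub_le_iff_le_add]
    refine le_ciInf fun i => sub_le_iff_le_add.2 ((ciInf_le (hbdd s) i).trans ?_)
    simp only [hq]
    rw [Real.dist_eq, min_add]
    refine min_le_min (by linarith [abs_nonneg (s - s')]) ?_
    rw [add_assoc]
    gcongr
    refine max_le (by positivity) ?_
    have h1 := le_max_right 0 ((i : ℝ) - s')
    have h2 := neg_abs_le (s - s')
    linarith
  · intro s s' h
    refine le_ciInf fun i => (ciInf_le (hbdd s') i).trans ?_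
    simp only [hq]
    gcongr
  · intro s
    set N := ⌈s⌉₊ + 1 with hN
    obtain ⟨c, hc0, hc⟩ : ∃ c : ℝ, 0 < c ∧ ∀ i < N, c ≤ ε i := by
      obtain ⟨i, -, hi⟩ := Finset.exists_min_image (Finset.range N) ε ⟨0, by simp [hN]⟩
      exact ⟨ε i, hε i, fun j hj => hi j (Finset.mem_range.2 hj)⟩
    refine (lt_min one_pos hc0).trans_le (le_ciInf fun i => le_min (min_le_left 1 c) ?_)
    rcases lt_or_ge i N with hi | hi
    · exact (min_le_right _ _).trans ((hc i hi).trans (by simp))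
    · have h1 : ((⌈s⌉₊ + 1 : ℕ) : ℝ) ≤ i := by exact_mod_cast hi
      have h2 := Nat.le_ceil s
      push_cast at h1
      have h3 := le_max_right 0 ((i : ℝ) - s)
      exact (min_le_left _ _).trans (by linarith [hε i])
  · exact fun s => (ciInf_le (hbdd s) 0).trans (min_le_left _ _)
  · intro i s hs
    refine (ciInf_le (hbdd s) i).trans ((min_le_right _ _).trans ?_)
    rw [max_eq_left (by linarith), add_zero]

section Systems

variable {E V : Type*} [NormedAddCommGroup E] [NormedSpace ℝ E] [NormedAddCommGroup V]
  [MeasurableSpace V] {f : E → V → E} {R : ℝ}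

namespace IsForwardCompleteSystem

variable (hf : IsForwardCompleteSystem f)
include hf

/-- Solutions with bounded inputs converge along ultrafilters, uniformly on those intervals on
which they are bounded. -/
theorem exists_limit_curve [ProperSpace E] {ι : Type*} {l : Ultrafilter ι} {u : ι → ℝ → V}
    {ξ : ι → ℝ → E} (hu : ∀ᶠ k in l, IsInput (u k) R)
    (hξ : ∀ k T, 0 ≤ T → IsSolutionOn f (u k) 0 T (ξ k)) {S : Set ℝ}
    (hS : ∀ T ∈ S, ∃ K, ∀ᶠ k in l, ∀ s ∈ Icc 0 T, ‖ξ k s‖ ≤ K) :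
    ∃ χ : ℝ → E, ∀ T ∈ S, ∀ d > 0, ∀ᶠ k in l, ∀ s ∈ Icc 0 T, ‖ξ k s - χ s‖ ≤ d := by
  have hpt : ∀ s, ∃ y, (∃ T ∈ S, s ∈ Icc 0 T) → Filter.Tendsto (fun k => ξ k s) l (nhds y) := by
    intro s
    by_cases h : ∃ T ∈ S, s ∈ Icc 0 T
    · obtain ⟨T, hT, hs⟩ := h
      obtain ⟨K, hK⟩ := hS T hT
      have hmem : Metric.closedBall (0 : E) K ∈ l.map fun k => ξ k s := by
        rw [Ultrafilter.mem_map]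
        filter_upwards [hK] with k hk
        simpa using hk s hs
      obtain ⟨y, -, hy⟩ := (isCompact_closedBall (0 : E) K).ultrafilter_le_nhds' _ hmem
      exact ⟨y, fun _ => hy⟩
    · exact ⟨0, fun h' => absurd h' h⟩
  choose χ hχ using hpt
  refine ⟨χ, fun T hT d hd => ?_⟩
  rcases lt_or_ge T 0 with hT0 | hT0
  · simp [Icc_eq_empty (not_le.2 hT0)]
  obtain ⟨K, hK⟩ := hS T hT
  obtain ⟨M, hM, hMb⟩ := hf.exists_bound (max K R)
  have hLip : ∀ᶠ k in l, ∀ s ∈ Icc 0 T, ∀ s' ∈ Icc 0 T, ‖ξ k s - ξ k s'‖ ≤ M * |s - s'| := by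
    filter_upwards [hK, hu] with k hk huk s hs s' hs'
    exact (hξ k T hT0).norm_sub_le huk (fun x v hx hv => hMb x v (hx.trans (le_max_left _ _))
      (hv.trans (le_max_right _ _))) hk hs' hs
  have hχLip : ∀ s ∈ Icc 0 T, ∀ s' ∈ Icc 0 T, ‖χ s - χ s'‖ ≤ M * |s - s'| := by
    intro s hs s' hs'
    refine le_of_tendsto ((hχ s ⟨T, hT, hs⟩).sub (hχ s' ⟨T, hT, hs'⟩)).norm ?_
    filter_upwards [hLip] with k hk
    exact hk s hs s' hs'
  obtain ⟨N, hNsub, hNfin, hN⟩ := (isCompact_Icc (a := (0 : ℝ)) (b := T)).finite_cover_balls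
    (e := d / (3 * M)) (by positivity)
  have hfin : ∀ᶠ k in l, ∀ p ∈ N, ‖ξ k p - χ p‖ ≤ d / 3 := by
    refine (Filter.eventually_all_finite hNfin).2 fun p hp => ?_
    have := tendsto_iff_norm_sub_tendsto_zero.1 (hχ p ⟨T, hT, hNsub hp⟩)
    exact (this.eventually (gt_mem_nhds (by positivity : (0 : ℝ) < d / 3))).mono fun k hk => hk.le
  filter_upwards [hfin, hLip] with k hk hkL s hs
  obtain ⟨p, hp, hsp⟩ := mem_iUnion₂.1 (hN hs)
  rw [Metric.mem_ball, Real.dist_eq] at hsp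
  have h1 : M * |s - p| ≤ d / 3 := by
    calc M * |s - p| ≤ M * (d / (3 * M)) := by gcongr
      _ = d / 3 := by field_simp
  have h2 := (hkL s hs p (hNsub hp)).trans h1
  have h3 := (hχLip s hs p (hNsub hp)).trans h1
  have h4 : ξ k s - χ s = (ξ k s - ξ k p) + (ξ k p - χ p) - (χ s - χ p) := by abel
  rw [h4]
  refine (norm_sub_le _ _).trans ((add_le_add (norm_add_le _ _) le_rfl).trans ?_)
  linarith [hk p hp]

/-- Forward completeness implies bounded reachability sets: otherwise a limit of solutions would
escape to infinity in finite time, and so would a solution shadowing it. -/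
theorem exists_reachability_bound [ProperSpace E] (R T : ℝ) : ∃ K, ∀ v ξ, IsInput v R →
    (∀ T, 0 ≤ T → IsSolutionOn f v 0 T ξ) → ‖ξ 0‖ ≤ R → ∀ s ∈ Icc 0 T, ‖ξ s‖ ≤ K := by
  by_contra! hcon
  choose v ξ hv hξ hξ0 p hp hlarge using fun k : ℕ => hcon k
  set l : Ultrafilter ℕ := Filter.hyperfilter ℕ with hl
  have hle : (l : Filter ℕ) ≤ Filter.atTop := by
    rw [hl, ← Nat.cofinite_eq_atTop]; exact Filter.hyperfilter_le_cofinite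
  -- times up to which the solutions are bounded along `l`; `ξ k` itself is larger than `k`
  -- somewhere on `[0, T]`, so that these times are below `T`
  set A : Set ℝ := {t | 0 ≤ t ∧ ∃ K, ∀ᶠ k in l, ∀ s ∈ Icc 0 t, ‖ξ k s‖ ≤ K} with hA
  have hAT : ∀ t ∈ A, t < T := by
    rintro t ⟨-, K, hK⟩
    by_contra htT
    push Not at htT
    obtain ⟨N, hN⟩ := exists_nat_ge K
    obtain ⟨k, hk, hkN⟩ := (hK.and (hle (Filter.eventually_ge_atTop N))).exists
    have h1 := hk (p k) ⟨(hp k).1, (hp k).2.trans htT⟩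
    have h2 := hlarge k
    have h3 : (N : ℝ) ≤ k := by exact_mod_cast hkN
    linarith
  -- boundedness extends by a time which depends only on the size of the state reached
  have hext : ∀ K, ∃ δ > 0, ∀ t ∈ A, (∀ᶠ k in l, ‖ξ k t‖ ≤ K) → t + δ ∈ A := by
    intro K
    obtain ⟨M, hM, hMb⟩ := hf.exists_bound (max (K + 1) R)
    refine ⟨1 / (2 * M), by positivity, ?_⟩
    rintro t ⟨ht0, K', hK'⟩ hK
    have hδ : (0 : ℝ) < 1 / (2 * M) := by positivity
    refine ⟨by linarith, max K' (K + 1), ?_⟩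
    filter_upwards [hK, hK'] with k hk hk' s hs
    rcases le_total s t with hst | hst
    · exact le_max_of_le_left (hk' s ⟨hs.1, hst⟩)
    · have hshort : (t + 1 / (2 * M) - t) * M < 1 := by
        have : (t + 1 / (2 * M) - t) * M = 1 / 2 := by field_simp; ring
        rw [this]; norm_num
      have h1 := ((hξ k (t + 1 / (2 * M)) (by linarith)).mono ht0 (by linarith)
        le_rfl).norm_sub_le_of_short (hv k)
        (fun x v hx hv => hMb x v (hx.trans (le_max_left _ _)) (hv.trans (le_max_right _ _)))
        hM.le hk hshort ⟨hst, hs.2⟩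
      have h2 : M * (s - t) ≤ (t + 1 / (2 * M) - t) * M := by
        rw [mul_comm]; gcongr; exact hs.2
      have h3 := norm_le_norm_add_norm_sub' (ξ k s) (ξ k t)
      exact le_max_of_le_right (by linarith)
  have h0A : (0 : ℝ) ∈ A := by
    refine ⟨le_rfl, R, Filter.Eventually.of_forall fun k s hs => ?_⟩
    obtain rfl : s = 0 := le_antisymm hs.2 hs.1
    exact hξ0 k
  have hAbdd : BddAbove A := ⟨T, fun t ht => (hAT t ht).le⟩
  set τ := sSup A with hτ
  have hτ0 : 0 < τ := by
    obtain ⟨δ, hδ, h⟩ := hext R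
    have := le_csSup hAbdd (h 0 h0A (Filter.Eventually.of_forall hξ0))
    linarith
  have hmemA : ∀ t, 0 ≤ t → t < τ → t ∈ A := by
    intro t ht0 ht
    obtain ⟨a, ⟨-, K, hK⟩, hta⟩ := exists_lt_of_lt_csSup ⟨0, h0A⟩ ht
    refine ⟨ht0, K, hK.mono fun k hk s hs => hk s ⟨hs.1, hs.2.trans hta.le⟩⟩
  obtain ⟨χ, hχ⟩ := hf.exists_limit_curve (l := l) (Filter.Eventually.of_forall hv) hξ
    (S := A) fun t ht => ht.2
  set t : ℕ → ℝ := fun j => τ * (1 - (1 / 2) ^ j) with htdef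
  have htmono : StrictMono t := by
    refine strictMono_nat_of_lt_succ fun j => ?_
    have : (0 : ℝ) < (1 / 2) ^ j := by positivity
    simp only [htdef, pow_succ]
    gcongr
    linarith
  have htA : ∀ j, t j ∈ A := fun j => by
    have h1 : (0 : ℝ) < (1 / 2) ^ j := by positivity
    have h2 : ((1 : ℝ) / 2) ^ j ≤ 1 := pow_le_one₀ (by norm_num) (by norm_num)
    refine hmemA _ (mul_nonneg hτ0.le (by linarith)) ?_
    simp only [htdef]
    nlinarith
  obtain ⟨w, ζ, -, hζ, hζχ⟩ := hf.exists_shadowing (l := (l : Filter ℕ))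
    (Filter.Eventually.of_forall hv) hξ (t := t) (by simp [htdef]) htmono
    (fun j => hχ _ (htA j)) (κ := fun _ => 1) continuous_const antitone_const
    (fun _ => one_pos) (fun _ => le_rfl)
  obtain ⟨B, hB⟩ := isCompact_Icc.exists_bound_of_continuousOn (hζ τ hτ0.le).1
  obtain ⟨δ, hδ, hδA⟩ := hext (B + 2)
  -- the shadowing solution is bounded by `B` up to time `τ`, so that `χ` and the solutions are of
  -- controlled size shortly before `τ`, and boundedness extends beyond `τ`
  set s := max 0 (τ - δ / 2) with hs
  have hs0 : 0 ≤ s := le_max_left _ _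
  have hsτ : s < τ := max_lt hτ0 (by linarith)
  have hsA := hmemA s hs0 hsτ
  have hχs : ‖χ s‖ ≤ B + 1 := by
    obtain ⟨j, hj⟩ := exists_pow_lt_of_lt_one (y := (1 / 2 : ℝ))
      (div_pos (sub_pos.2 hsτ) hτ0) (by norm_num)
    rw [lt_div_iff₀ hτ0] at hj
    have hsj : s ≤ t j := by simp only [htdef]; linarith
    have h1 := hζχ j s ⟨hs0, hsj⟩
    have h2 := hB s ⟨hs0, hsτ.le⟩
    have h3 := norm_le_norm_add_norm_sub (ζ s) (χ s)
    linarith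
  have hξs : ∀ᶠ k in l, ‖ξ k s‖ ≤ B + 2 := by
    filter_upwards [hχ s hsA 1 one_pos] with k hk
    have h1 := hk s ⟨hs0, le_rfl⟩
    have h2 := norm_le_norm_add_norm_sub' (ξ k s) (χ s)
    linarith
  have h1 := le_csSup hAbdd (hδA s hsA hξs)
  have h2 : τ - δ / 2 ≤ s := le_max_right _ _
  linarith

/-- If solutions starting in a bounded set keep a continuous function `g` of the state above `c`
during longer and longer times, then for every `c' < c` some solution keeps `g` above `c'`
forever. -/
theorem exists_solution_avoiding [ProperSpace E] {l : Ultrafilter ℕ}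
    (hl : (l : Filter ℕ) ≤ Filter.atTop) {u : ℕ → ℝ → V} {ξ : ℕ → ℝ → E}
    (hu : ∀ᶠ k in l, IsInput (u k) R) (hξ : ∀ k T, 0 ≤ T → IsSolutionOn f (u k) 0 T (ξ k))
    {r : ℝ} (hr : ∀ k, ‖ξ k 0‖ ≤ r) {g : E → ℝ} (hg : Continuous g) {c c' : ℝ} (hc : c' < c)
    (hav : ∀ᶠ k : ℕ in l, ∀ s ∈ Icc (0 : ℝ) k, c ≤ g (ξ k s)) :
    ∃ w ζ, IsInput w R ∧ (∀ T, 0 ≤ T → IsSolutionOn f w 0 T ζ) ∧ ∀ s, 0 ≤ s → c' < g (ζ s) := by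
  have hbd : ∀ T : ℝ, ∃ K, ∀ᶠ k in l, ∀ s ∈ Icc 0 T, ‖ξ k s‖ ≤ K := by
    intro T
    obtain ⟨K, hK⟩ := hf.exists_reachability_bound (max r R) T
    refine ⟨K, hu.mono fun k hk => hK _ _ ⟨hk.1, fun s => (hk.2 s).trans (le_max_right _ _)⟩
      (hξ k) ((hr k).trans (le_max_left _ _))⟩
  obtain ⟨χ, hχ⟩ := hf.exists_limit_curve hu hξ (S := univ) fun T _ => hbd T
  have hgχ : ∀ s, 0 ≤ s → c ≤ g (χ s) := by
    intro s hs
    have hlim : Filter.Tendsto (fun k => ξ k s) l (nhds (χ s)) := by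
      rw [tendsto_iff_norm_sub_tendsto_zero, Metric.tendsto_nhds]
      intro d hd
      filter_upwards [hχ s (mem_univ s) (d / 2) (half_pos hd)] with k hk
      rw [dist_zero_right, norm_norm]
      exact (hk s ⟨hs, le_rfl⟩).trans_lt (half_lt_self hd)
    refine ge_of_tendsto ((hg.tendsto _).comp hlim) ?_
    obtain ⟨N, hN⟩ := exists_nat_ge s
    filter_upwards [hav, hl (Filter.eventually_ge_atTop N)] with k hk hkN
    exact hk s ⟨hs, hN.trans (by exact_mod_cast hkN)⟩
  have htol : ∀ j : ℕ, ∃ ε > 0, ∀ s ∈ Icc (0 : ℝ) (j + 1), ∀ x, ‖x - χ s‖ ≤ ε → c' < g x := by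
    intro j
    obtain ⟨K, hK⟩ := hbd (j + 1)
    have hχK : ∀ s ∈ Icc (0 : ℝ) (j + 1), ‖χ s‖ ≤ K + 1 := by
      obtain ⟨k, hk, hk'⟩ := (hK.and (hχ (j + 1) (mem_univ _) 1 one_pos)).exists
      intro s hs
      have h1 := norm_le_norm_add_norm_sub (ξ k s) (χ s)
      linarith [hk s hs, hk' s hs]
    obtain ⟨ε, hε, h⟩ := Metric.uniformContinuousOn_iff.1
      ((isCompact_closedBall (0 : E) (K + 2)).uniformContinuousOn_of_continuous hg.continuousOn)
      (c - c') (sub_pos.2 hc)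
    refine ⟨min 1 (ε / 2), by positivity, fun s hs x hx => ?_⟩
    have h1 : ‖x‖ ≤ K + 2 := by
      have := norm_le_norm_add_norm_sub' x (χ s)
      linarith [hχK s hs, hx.trans (min_le_left _ _)]
    have h2 := h x (by simpa using h1) (χ s) (by simpa using (hχK s hs).trans (by linarith)) (by
      rw [dist_eq_norm]
      exact (hx.trans (min_le_right _ _)).trans_lt (half_lt_self hε))
    rw [Real.dist_eq] at h2
    have h3 := (abs_lt.1 h2).1
    linarith [hgχ s hs.1]
  choose ε hε htol using htol
  obtain ⟨κ, hκ, hκa, hκ0, hκ1, hκε⟩ := exists_continuous_antitone_minorant hε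
  obtain ⟨w, ζ, hw, hζ, hζχ⟩ := hf.exists_shadowing (l := (l : Filter ℕ)) hu hξ
    (t := fun j => (j : ℝ)) (by simp) Nat.strictMono_cast (fun j => hχ j (mem_univ _))
    hκ hκa hκ0 hκ1
  refine ⟨w, ζ, hw, hζ, fun s hs => ?_⟩
  have h1 : s ≤ (⌊s⌋₊ + 1 : ℕ) := by push_cast; exact (Nat.lt_floor_add_one s).le
  refine htol ⌊s⌋₊ s ⟨hs, by exact_mod_cast h1⟩ _ ((hζχ _ s ⟨hs, h1⟩).trans ?_)
  exact hκε _ _ (Nat.floor_le hs)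

end IsForwardCompleteSystem

end Systems

/-! ### Output stability in terms of solutions with bounded inputs -/

section Systems

variable {E V Y : Type*} [NormedAddCommGroup E] [NormedSpace ℝ E] [NormedAddCommGroup V]
  [MeasurableSpace V] [NormedAddCommGroup Y] {f : E → V → E} {h : E → Y} {R : ℝ≥0} {ξ : ℝ → E}

/-- `ξ` is a solution on `[0, ∞)` for some input bounded by `R`. -/
def IsSolutionWithBound (f : E → V → E) (R : ℝ≥0) (ξ : ℝ → E) : Prop :=
  ∃ v, IsInput v (R : ℝ) ∧ ∀ T, 0 ≤ T → IsSolutionOn f v 0 T ξ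

theorem IsSolutionWithBound.comp_add (hξ : IsSolutionWithBound f R ξ) (a : ℝ≥0) :
    IsSolutionWithBound f R fun s => ξ (s + a) := by
  obtain ⟨v, hv, hsol⟩ := hξ
  refine ⟨_, hv.comp_add a, fun T hT => ?_⟩
  have := ((hsol (T + a) (by positivity)).mono a.2 (by simpa using hT) le_rfl).comp_add (a : ℝ)
  simpa using this

/-- A solution starting at an equilibrium can be delayed. -/
theorem IsSolutionWithBound.exists_delay (hf0 : f 0 0 = 0) (hξ : IsSolutionWithBound f R ξ)
    (h0 : ξ 0 = 0) (a : ℝ≥0) :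
    ∃ ζ, IsSolutionWithBound f R ζ ∧ ζ 0 = 0 ∧ ∀ s, 0 ≤ s → ζ (s + a) = ξ s := by
  obtain ⟨v, hv, hsol⟩ := hξ
  set w : ℝ → V := fun s => if s ≤ a then 0 else v (s - a) with hw
  set ζ : ℝ → E := fun s => if s ≤ a then 0 else ξ (s - a) with hζ
  have ha : (0 : ℝ) ≤ a := a.2
  have hw1 : IsInput w (R : ℝ) := by
    refine ⟨Measurable.ite measurableSet_Iic measurable_const
      (hv.measurable.comp (measurable_id.sub_const _)), fun s => ?_⟩
    simp only [hw]
    split_ifs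
    · simp
    · exact hv.norm_le _
  have hζξ : ∀ s, (a : ℝ) ≤ s → ζ s = ξ (s - a) := by
    intro s hs
    rcases hs.eq_or_lt with rfl | hs
    · simp [hζ, h0]
    · simp [hζ, not_le.2 hs]
  have h1 : IsSolutionOn f w 0 a ζ := by
    have hζ0 : ∀ s ≤ (a : ℝ), ζ s = 0 := fun s hs => by simp [hζ, hs]
    have hfs : ∀ s ≤ (a : ℝ), f (ζ s) (w s) = 0 := fun s hs => by
      rw [hζ0 s hs]
      simp [hw, hs, hf0]
    refine ⟨continuousOn_const.congr fun s hs => hζ0 s hs.2, ?_, fun t ht => ?_⟩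
    · refine (intervalIntegrable_const (c := (0 : E))).congr fun s hs => ?_
      rw [uIoc_of_le ha] at hs
      exact (hfs s hs.2).symm
    · rw [hζ0 t ht.2, hζ0 0 ha, intervalIntegral.integral_congr (g := fun _ => (0 : E))]
      · simp
      · intro s hs
        rw [uIcc_of_le ht.1] at hs
        exact hfs s (hs.2.trans ht.2)
  have h2 : ∀ T, (a : ℝ) ≤ T → IsSolutionOn f w a T ζ := by
    intro T hT
    have hs := (hsol (T - a) (by linarith)).comp_add (-(a : ℝ))
    simp only [sub_neg_eq_add, zero_add, sub_add_cancel, ← sub_eq_add_neg] at hs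
    have hs2 := hs.congr_input (w := w) hT (Filter.Eventually.of_forall fun s hs => by
      simp [hw, not_le.2 hs.1])
    exact hs2.congr_curve hT fun s hs => (hζξ s hs.1).symm
  refine ⟨ζ, ⟨w, hw1, fun T hT => ?_⟩, by simp [hζ], fun s hs => ?_⟩
  · exact (h1.trans (h2 (a + T) (by linarith)) ha (by linarith)).mono le_rfl hT (by linarith)
  · rw [hζξ _ (by linarith), add_sub_cancel_right]

namespace IsForwardCompleteSystem

variable (hf : IsForwardCompleteSystem f)
include hf

/-- The limit property is automatically uniform with respect to bounded sets of initial states and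
inputs. -/
theorem exists_uniform_time [ProperSpace E] (hh : Continuous h) {γ : ℝ≥0 → ℝ≥0}
    (hγ : IsClassKInf γ)
    (hlim : ∀ ε, 0 < ε → ∀ R ξ, IsSolutionWithBound f R ξ → ∃ t : ℝ≥0, ‖h (ξ t)‖₊ ≤ ε + γ R)
    {ε : ℝ≥0} (hε : 0 < ε) (r R₀ : ℝ≥0) :
    ∃ τ : ℝ≥0, ∀ R ξ, R ≤ R₀ → IsSolutionWithBound f R ξ → ‖ξ 0‖₊ ≤ r →
      ∃ t ≤ τ, ‖h (ξ t)‖₊ ≤ ε + γ R := by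
  by_contra! hcon
  choose R ξ hR hξ hξ0 hbig using fun k : ℕ => hcon k
  choose v hv hsol using hξ
  set l : Ultrafilter ℕ := Filter.hyperfilter ℕ with hl
  have hle : (l : Filter ℕ) ≤ Filter.atTop := by
    rw [hl, ← Nat.cofinite_eq_atTop]; exact Filter.hyperfilter_le_cofinite
  -- the bounds of the inputs converge, to `Rb`, and are eventually below a slightly larger `R'`
  obtain ⟨Rb, -, hRb⟩ := (isCompact_Icc (a := (0 : ℝ≥0)) (b := R₀)).ultrafilter_le_nhds'
    (l.map R) (by
      rw [Ultrafilter.mem_map]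
      exact Filter.Eventually.of_forall fun k => ⟨zero_le, hR k⟩)
  have hRlim : Filter.Tendsto R l (nhds Rb) := hRb
  have hε4 : 0 < ε / 4 := by positivity
  obtain ⟨R', hR', hγR'⟩ : ∃ R', Rb < R' ∧ γ R' < γ Rb + ε / 4 := by
    have h1 := (hγ.1.2.1.tendsto Rb).eventually (gt_mem_nhds (lt_add_of_pos_right _ hε4))
    have h2 : ∀ᶠ q in nhdsWithin Rb (Ioi Rb), γ q < γ Rb + ε / 4 := h1.filter_mono inf_le_left
    obtain ⟨q, hq, hq'⟩ := (h2.and self_mem_nhdsWithin).exists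
    exact ⟨q, hq', hq⟩
  have hevR : ∀ᶠ k in l, R k < R' := hRlim.eventually (gt_mem_nhds hR')
  have hevγ : ∀ᶠ k in l, (γ Rb : ℝ) - ε / 4 < γ (R k) := by
    have h1 : Filter.Tendsto (fun k => (γ (R k) : ℝ)) l (nhds (γ Rb : ℝ)) :=
      NNReal.tendsto_coe.2 ((hγ.1.2.1.tendsto Rb).comp hRlim)
    have h2 : (0 : ℝ) < ε := hε
    exact h1.eventually (lt_mem_nhds (by linarith))
  have hε0 : (0 : ℝ) < ε := hε
  have hγR'' : (γ R' : ℝ) < γ Rb + ε / 4 := by exact_mod_cast hγR'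
  have hav : ∀ᶠ k : ℕ in l, ∀ s ∈ Icc (0 : ℝ) k, (ε / 2 + γ R' : ℝ) ≤ ‖h (ξ k s)‖ := by
    filter_upwards [hevγ] with k hk s hs
    lift s to ℝ≥0 using hs.1
    have h1 := hbig k s (by exact_mod_cast hs.2)
    rw [← NNReal.coe_lt_coe] at h1
    push_cast at h1
    change (ε : ℝ) + γ (R k) < ‖h (ξ k s)‖ at h1
    linarith
  obtain ⟨w, ζ, hw, hζ, hζbig⟩ := hf.exists_solution_avoiding hle (R := R') (u := v) (ξ := ξ)
    (r := r) (g := fun x => ‖h x‖) (c := ε / 2 + γ R') (c' := ε / 4 + γ R')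
    (hevR.mono fun k hk => ⟨(hv k).measurable, fun s =>
      ((hv k).norm_le s).trans (by exact_mod_cast hk.le)⟩)
    hsol (fun k => by exact_mod_cast hξ0 k) hh.norm (by linarith) hav
  obtain ⟨t, ht⟩ := hlim (ε / 4) hε4 R' ζ ⟨w, hw, hζ⟩
  have h1 := hζbig t t.2
  rw [← NNReal.coe_le_coe] at ht
  push_cast at ht
  linarith

/-- The uniform asymptotic gain property implies a bound by a `𝒦∞` function of the size of the
initial state and of the input, for all times. -/
theorem exists_output_bound [ProperSpace E] (hh : Continuous h) (hf0 : f 0 0 = 0)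
    {γ : ℝ≥0 → ℝ≥0} (hγ : IsClassKInf γ)
    (hag : ∀ ε r s : ℝ≥0, 0 < ε → 0 < r → 0 < s → ∃ τ : ℝ≥0, ∀ R ξ, IsSolutionWithBound f R ξ →
      ‖ξ 0‖₊ < r → R < s → ∀ t : ℝ≥0, τ ≤ t → ‖h (ξ t)‖₊ ≤ ε + γ R) :
    ∃ σ, IsClassKInf σ ∧ ∀ R ξ, IsSolutionWithBound f R ξ → ∀ t : ℝ≥0,
      ‖h (ξ t)‖₊ ≤ σ (max ‖ξ 0‖₊ R) := by
  have hzero : ∀ R ξ, IsSolutionWithBound f R ξ → ξ 0 = 0 → ∀ t : ℝ≥0, ‖h (ξ t)‖₊ ≤ γ R := by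
    intro R ξ hξ h0 t
    refine le_of_forall_pos_le_add fun ε hε => ?_
    obtain ⟨τ, hτ⟩ := hag ε 1 (R + 1) hε one_pos (by positivity)
    obtain ⟨ζ, hζ, hζ0, hζξ⟩ := hξ.exists_delay hf0 h0 τ
    have := hτ R ζ hζ (by simp [hζ0]) (lt_add_one R) (t + τ) le_add_self
    rw [NNReal.coe_add, hζξ t t.2, add_comm] at this
    exact this
  set ι := {p : ℝ≥0 × (ℝ → E) × ℝ≥0 // IsSolutionWithBound f p.1 p.2.1} with hι
  suffices H : ∃ σ, IsClassKInf σ ∧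
      ∀ p : ι, ‖h (p.1.2.1 p.1.2.2)‖₊ ≤ σ (max ‖p.1.2.1 0‖₊ p.1.1) by
    obtain ⟨σ, hσ, hσb⟩ := H
    exact ⟨σ, hσ, fun R ξ hξ t => hσb ⟨(R, ξ, t), hξ⟩⟩
  refine exists_isClassKInf_majorant ?_ ?_
  · intro r
    obtain ⟨τ, hτ⟩ := hag 1 (r + 1) (r + 1) one_pos (by positivity) (by positivity)
    obtain ⟨K, hK⟩ := hf.exists_reachability_bound r τ
    obtain ⟨C, hC⟩ := (isCompact_closedBall (0 : E) K).exists_bound_of_continuousOn hh.continuousOn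
    refine ⟨max (1 + γ r) C.toNNReal, ?_⟩
    rintro ⟨⟨R, ξ, t⟩, hξ⟩ hp
    have hp1 : ‖ξ 0‖₊ ≤ r := (le_max_left _ _).trans hp
    have hp2 : R ≤ r := (le_max_right _ _).trans hp
    change ‖h (ξ t)‖₊ ≤ _
    rcases le_total τ t with ht | ht
    · refine le_max_of_le_left ((hτ R ξ hξ (hp1.trans_lt (lt_add_one r))
        (hp2.trans_lt (lt_add_one r)) t ht).trans ?_)
      gcongr
      exact hγ.1.2.2.monotone hp2
    · obtain ⟨v, hv, hsol⟩ := hξ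
      refine le_max_of_le_right ?_
      rw [← norm_toNNReal]
      refine Real.toNNReal_mono (hC _ ?_)
      rw [mem_closedBall_zero_iff]
      exact hK v ξ ⟨hv.1, fun s => (hv.2 s).trans hp2⟩ hsol hp1 t ⟨t.2, ht⟩
  · intro ε hε
    have hε2 : 0 < ε / 2 := half_pos hε
    obtain ⟨τ, hτ⟩ := hag (ε / 2) 2 2 hε2 two_pos two_pos
    obtain ⟨K, hK⟩ := hf.exists_reachability_bound 1 τ
    obtain ⟨L, hL, hLip⟩ := hf.lipschitz (max K 1)
    obtain ⟨d, hd, hdh⟩ := Metric.uniformContinuousOn_iff.1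
      ((isCompact_closedBall (0 : E) K).uniformContinuousOn_of_continuous hh.continuousOn)
      (ε / 2) hε2
    obtain ⟨δ₁, hδ₁, hγδ⟩ := hγ.1.exists_pos_le hε2
    set δ₂ : ℝ := d / 2 * Real.exp (-(L * τ)) with hδ₂def
    have hδ₂ : 0 < δ₂ := by positivity
    refine ⟨min (min 1 δ₁) δ₂.toNNReal, lt_min (lt_min one_pos hδ₁) (Real.toNNReal_pos.2 hδ₂), ?_⟩
    rintro ⟨⟨R, ξ, t⟩, hξ⟩ hp
    have hp1 : ‖ξ 0‖₊ ≤ 1 :=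
      (le_max_left _ _).trans (hp.trans ((min_le_left _ _).trans (min_le_left _ _)))
    have hp2 : R ≤ 1 :=
      (le_max_right _ _).trans (hp.trans ((min_le_left _ _).trans (min_le_left _ _)))
    have hp3 : R ≤ δ₁ :=
      (le_max_right _ _).trans (hp.trans ((min_le_left _ _).trans (min_le_right _ _)))
    have hp4 : ‖ξ 0‖ ≤ δ₂ := by
      rw [← coe_nnnorm, ← Real.le_toNNReal_iff_coe_le hδ₂.le]
      exact (le_max_left _ _).trans (hp.trans (min_le_right _ _))
    change ‖h (ξ t)‖₊ ≤ ε
    rcases le_total τ t with ht | ht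
    · refine (hτ R ξ hξ (hp1.trans_lt one_lt_two) (hp2.trans_lt one_lt_two) t ht).trans ?_
      calc ε / 2 + γ R ≤ ε / 2 + ε / 2 := by gcongr; exact hγδ R hp3
        _ = ε := add_halves ε
    · -- comparison with the solution starting at the origin, for the same input
      obtain ⟨v, hv, hsol⟩ := hξ
      obtain ⟨ζ, hζ0, hζ⟩ := hf.exists_solution v R hv 0
      have hv1 : IsInput v 1 := ⟨hv.1, fun s => (hv.2 s).trans hp2⟩
      have hξK := hK v ξ hv1 hsol hp1
      have hζK := hK v ζ hv1 hζ (by simp [hζ0])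
      have htτ : (t : ℝ) ∈ Icc (0 : ℝ) τ := ⟨t.2, ht⟩
      have h1 := (hsol τ τ.2).norm_sub_le_exp (hζ τ τ.2) hL (fun s hs => hLip _ _ _
        ((hξK s hs).trans (le_max_left _ _)) ((hζK s hs).trans (le_max_left _ _))
        ((hv1.norm_le s).trans (le_max_right _ _))) htτ
      rw [hζ0, sub_zero, sub_zero] at h1
      have h2 : ‖ξ t - ζ t‖ < d := by
        refine (h1.trans (mul_le_mul hp4 (Real.exp_le_exp.2
          (mul_le_mul_of_nonneg_left htτ.2 hL.le)) (Real.exp_pos _).le hδ₂.le)).trans_lt ?_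
        rw [hδ₂def, mul_assoc, ← Real.exp_add, neg_add_cancel, Real.exp_zero, mul_one]
        exact half_lt_self hd
      have h3 := hdh (ξ t) (by simpa using hξK t htτ) (ζ t) (by simpa using hζK t htτ)
        (by rwa [dist_eq_norm])
      rw [dist_eq_norm] at h3
      have h4 := hzero R ζ ⟨v, hv, hζ⟩ hζ0 t
      have h5 : (γ R : ℝ) ≤ ε / 2 := by exact_mod_cast hγδ R hp3
      have h6 : ‖h (ζ t)‖ ≤ γ R := h4
      have h7 := norm_le_norm_add_norm_sub' (h (ξ t)) (h (ζ t))
      rw [← NNReal.coe_le_coe, coe_nnnorm]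
      linarith

end IsForwardCompleteSystem

end Systems

/-! ### Inputs as elements of `InputSpace` -/

section Transition

variable {n m : ℕ}
  {f : EuclideanSpace ℝ (Fin n) → EuclideanSpace ℝ (Fin m) → EuclideanSpace ℝ (Fin n)}

theorem IsInput.exists_inputSpace {v : ℝ → EuclideanSpace ℝ (Fin m)} {R : ℝ} (hv : IsInput v R) :
    ∃ u : InputSpace m, u =ᵐ[volume.restrict (Ici (0 : ℝ))] v ∧ ‖u‖ ≤ R := by
  have hR : 0 ≤ R := (norm_nonneg _).trans (hv.norm_le 0)
  have hb : ∀ᵐ s ∂(volume.restrict (Ici (0 : ℝ))), ‖v s‖ ≤ R :=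
    Filter.Eventually.of_forall hv.norm_le
  have hm : MemLp v ∞ (volume.restrict (Ici (0 : ℝ))) :=
    memLp_top_of_bound hv.measurable.aestronglyMeasurable R hb
  refine ⟨hm.toLp v, hm.coeFn_toLp, ?_⟩
  rw [Lp.norm_toLp, eLpNorm_exponent_top]
  refine ENNReal.toReal_le_of_le_ofReal hR (essSup_le_of_ae_le _ ?_)
  filter_upwards [hb] with s hs
  rw [← ofReal_norm]
  exact ENNReal.ofReal_le_ofReal hs

theorem InputSpace.exists_isInput (u : InputSpace m) :
    ∃ v, IsInput v ‖u‖ ∧ u =ᵐ[volume.restrict (Ici (0 : ℝ))] v := by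
  have hsm : Measurable (u : ℝ → EuclideanSpace ℝ (Fin m)) := (Lp.stronglyMeasurable u).measurable
  refine ⟨{s | ‖u s‖ ≤ ‖u‖}.indicator u, ⟨hsm.indicator (measurableSet_le hsm.norm
    measurable_const), fun s => ?_⟩, ?_⟩
  · by_cases hs : ‖u s‖ ≤ ‖u‖
    · rwa [indicator_of_mem (by exact hs)]
    · rw [indicator_of_notMem (by exact hs), norm_zero]; exact norm_nonneg _
  · filter_upwards [ae_le_eLpNormEssSup (f := (u : ℝ → EuclideanSpace ℝ (Fin m)))
      (μ := volume.restrict (Ici (0 : ℝ)))] with s hs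
    have h1 : ‖u s‖ ≤ ‖u‖ := by
      rw [Lp.norm_def, eLpNorm_exponent_top, ← toReal_enorm]
      refine ENNReal.toReal_mono ?_ hs
      have := Lp.eLpNorm_ne_top u
      rwa [eLpNorm_exponent_top] at this
    rw [indicator_of_mem (by exact h1)]

theorem isTrajectory_iff {x₀ : EuclideanSpace ℝ (Fin n)} {u : InputSpace m}
    {v : ℝ → EuclideanSpace ℝ (Fin m)} (huv : u =ᵐ[volume.restrict (Ici (0 : ℝ))] v)
    {ξ : ℝ → EuclideanSpace ℝ (Fin n)} :
    IsTrajectory f x₀ u ξ ↔ ξ 0 = x₀ ∧ ∀ T, 0 ≤ T → IsSolutionOn f v 0 T ξ := by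
  have huv' : ∀ T, ∀ᵐ s, s ∈ Ioc (0 : ℝ) T → u s = v s := fun T => by
    filter_upwards [(ae_restrict_iff' measurableSet_Ici).1 huv] with s hs hsT
    exact hs hsT.1.le
  constructor
  · rintro ⟨hc, hξ⟩
    have h0 : ξ 0 = x₀ := by simpa using (hξ 0 le_rfl).2
    refine ⟨h0, fun T hT => IsSolutionOn.congr_input (v := u) ⟨hc.mono Icc_subset_Ici_self,
      (hξ T hT).1, fun t ht => ?_⟩ hT (huv' T)⟩
    rw [h0]
    exact (hξ t ht.1).2
  · rintro ⟨rfl, hξ⟩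
    refine ⟨fun s hs => ?_, fun t ht => ?_⟩
    · have hs' : (0 : ℝ) ≤ s := hs
      refine ((hξ (s + 1) (by linarith)).1 s ⟨hs', by linarith⟩).mono_of_mem_nhdsWithin ?_
      have : Iio (s + 1) ∈ nhds s := Iio_mem_nhds (lt_add_one s)
      filter_upwards [self_mem_nhdsWithin, mem_nhdsWithin_of_mem_nhds this] with q hq hq'
      exact ⟨hq, le_of_lt hq'⟩
    · have h1 := (hξ t ht).congr_input (w := u) ht ((huv' t).mono fun s hs hst => (hs hst).symm)
      exact ⟨h1.2.1, h1.2.2 t ⟨ht, le_rfl⟩⟩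

theorem ForwardComplete.isForwardCompleteSystem (hFC : ForwardComplete f)
    (hf : LipschitzFstOnBounded f) : IsForwardCompleteSystem f where
  lipschitz r := by
    obtain ⟨L, hL, hLip⟩ := hf (|r| + 1) (by positivity)
    have hr : r < |r| + 1 := (le_abs_self r).trans_lt (lt_add_one _)
    exact ⟨L, hL, fun x₁ x₂ v h₁ h₂ hv =>
      hLip x₁ x₂ v (h₁.trans_lt hr) (h₂.trans_lt hr) (hv.trans_lt hr)⟩
  exists_solution v R hv x := by
    obtain ⟨u, huv, -⟩ := hv.exists_inputSpace
    obtain ⟨ξ, hξ⟩ := hFC x u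
    exact ⟨ξ, (isTrajectory_iff huv).1 hξ⟩

theorem IsSolutionWithBound.exists_transitionMap_eq (hf : LipschitzFstOnBounded f) {R : ℝ≥0}
    {ξ : ℝ → EuclideanSpace ℝ (Fin n)} (hξ : IsSolutionWithBound f R ξ) :
    ∃ u : InputSpace m, ‖u‖₊ ≤ R ∧ ∀ t : ℝ≥0, transitionMap f t (ξ 0) u = ξ t := by
  obtain ⟨v, hv, hsol⟩ := hξ
  obtain ⟨u, huv, hu⟩ := hv.exists_inputSpace
  exact ⟨u, hu, ((isTrajectory_iff huv).2 ⟨rfl, hsol⟩).eq_transitionMap hf⟩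

theorem exists_isSolutionWithBound_eq_transitionMap (hf : LipschitzFstOnBounded f)
    (hFC : ForwardComplete f) (x : EuclideanSpace ℝ (Fin n)) (u : InputSpace m) :
    ∃ ξ, IsSolutionWithBound f ‖u‖₊ ξ ∧ ξ 0 = x ∧ ∀ t : ℝ≥0, transitionMap f t x u = ξ t := by
  obtain ⟨v, hv, huv⟩ := InputSpace.exists_isInput u
  obtain ⟨ξ, hξ⟩ := hFC x u
  have h1 := (isTrajectory_iff huv).1 hξ
  exact ⟨ξ, ⟨v, hv, h1.2⟩, h1.1, hξ.eq_transitionMap hf⟩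

end Transition

/-! ### The characterizations -/

section Main

variable {n m : ℕ} {Y : Type*} [NormedAddCommGroup Y]
  {f : EuclideanSpace ℝ (Fin n) → EuclideanSpace ℝ (Fin m) → EuclideanSpace ℝ (Fin n)}
  {h : EuclideanSpace ℝ (Fin n) → Y}

theorem IsOGUAG.isOLIM {X 𝒰 : Type*} [NormedAddCommGroup X] [NormedAddCommGroup 𝒰]
    {y : ℝ≥0 → X → 𝒰 → Y} (hy : IsOGUAG y) : IsOLIM y := by
  obtain ⟨γ, hγ, H⟩ := hy
  refine ⟨γ, hγ, fun ε hε x u => ?_⟩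
  obtain ⟨τ, hτ⟩ := H ε (‖x‖₊ + 1) hε (by positivity)
  exact ⟨τ, hτ x u τ (lt_add_one _) le_rfl⟩

theorem IsIOS.isOUAG {X 𝒰 : Type*} [NormedAddCommGroup X] [NormedAddCommGroup 𝒰]
    {y : ℝ≥0 → X → 𝒰 → Y} (hy : IsIOS y) : IsOUAG y := by
  obtain ⟨β, γ, hβ, hγ, H⟩ := hy
  refine ⟨γ, hγ, fun ε r s hε hr _ => ?_⟩
  obtain ⟨τ, hτ⟩ := ((hβ.2 r hr).2.2.eventually (gt_mem_nhds hε)).exists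
  refine ⟨τ, fun x u t hx _ ht => (H x u t).trans ?_⟩
  gcongr
  calc β ‖x‖₊ t ≤ β r t := (hβ.1 t).2.2.monotone hx.le
    _ ≤ β r τ := (hβ.2 r hr).2.1 ht
    _ ≤ ε := hτ.le

theorem isOGUAG_of_isOLIM_of_isOL (hf : LipschitzFstOnBounded f) (hFC : ForwardComplete f)
    (hh : Continuous h) (hlim : IsOLIM (odeOutput f h)) (hol : IsOL (odeOutput f h)) :
    IsOGUAG (odeOutput f h) := by
  have hs := hFC.isForwardCompleteSystem hf
  obtain ⟨γ₁, hγ₁, hlim⟩ := hlim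
  obtain ⟨σ, γ₂, hσ, hγ₂, hol⟩ := hol
  have hol' : ∀ R ξ, IsSolutionWithBound f R ξ → ∀ t : ℝ≥0,
      ‖h (ξ t)‖₊ ≤ σ ‖h (ξ 0)‖₊ + γ₂ R := by
    intro R ξ hξ t
    obtain ⟨u, hu, hmap⟩ := hξ.exists_transitionMap_eq hf
    have h1 := hol (ξ 0) u t
    simp only [odeOutput, hmap] at h1
    refine h1.trans ?_
    rw [NNReal.coe_zero]
    gcongr
    exact hγ₂.1.2.2.monotone hu
  have hlim' : ∀ ε, 0 < ε → ∀ R ξ, IsSolutionWithBound f R ξ →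
      ∃ t : ℝ≥0, ‖h (ξ t)‖₊ ≤ ε + γ₁ R := by
    intro ε hε R ξ hξ
    obtain ⟨u, hu, hmap⟩ := hξ.exists_transitionMap_eq hf
    obtain ⟨t, ht⟩ := hlim ε hε (ξ 0) u
    simp only [odeOutput, hmap] at ht
    refine ⟨t, ht.trans ?_⟩
    gcongr
    exact hγ₁.1.2.2.monotone hu
  have hγd : IsClassKInf fun r => σ (2 * γ₁ r) := by
    have h1 : IsClassKInf fun r => 2 * γ₁ r := by
      simpa only [two_mul] using hγ₁.add hγ₁
    exact hσ.comp h1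
  refine ⟨_, hγd.add (hγ₂.add hγ₂), fun ε r hε hr => ?_⟩
  obtain ⟨C, hC⟩ := (isCompact_closedBall (0 : EuclideanSpace ℝ (Fin n))
    (r : ℝ)).exists_bound_of_continuousOn hh.continuousOn
  -- large inputs are dealt with by the Lagrange estimate alone
  obtain ⟨R₀, hR₀⟩ := hγ₂.exists_le (σ C.toNNReal)
  obtain ⟨δ, hδ, hσδ⟩ := hσ.1.exists_pos_le hε
  obtain ⟨τ, hτ⟩ := hs.exists_uniform_time hh hγ₁ hlim' (half_pos hδ) r R₀
  refine ⟨τ, fun x u t hx ht => ?_⟩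
  obtain ⟨ξ, hξ, rfl, hmap⟩ := exists_isSolutionWithBound_eq_transitionMap hf hFC x u
  simp only [odeOutput, hmap]
  rcases le_total ‖u‖₊ R₀ with hu | hu
  · obtain ⟨s, hsτ, hs⟩ := hτ _ ξ hu hξ hx.le
    have h1 := hol' _ _ (hξ.comp_add s) (t - s)
    have h2 : ((t - s : ℝ≥0) : ℝ) + s = t := by
      rw [NNReal.coe_sub (hsτ.trans ht), sub_add_cancel]
    simp only [h2, zero_add] at h1
    have h3 : σ ‖h (ξ s)‖₊ ≤ ε + σ (2 * γ₁ ‖u‖₊) := by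
      refine (hσ.1.2.2.monotone hs).trans ((hσ.1.2.2.monotone.apply_add_le _ _).trans ?_)
      gcongr
      exact hσδ _ (mul_div_cancel₀ _ two_ne_zero).le
    calc ‖h (ξ t)‖₊ ≤ (ε + σ (2 * γ₁ ‖u‖₊)) + γ₂ ‖u‖₊ := h1.trans (by gcongr)
      _ ≤ ε + (σ (2 * γ₁ ‖u‖₊) + (γ₂ ‖u‖₊ + γ₂ ‖u‖₊)) := by
        rw [add_assoc]; gcongr; exact le_self_add
  · have h1 : σ ‖h (ξ 0)‖₊ ≤ γ₂ ‖u‖₊ := by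
      refine (hσ.1.2.2.monotone ?_).trans (hR₀.trans (hγ₂.1.2.2.monotone hu))
      rw [← norm_toNNReal]
      refine Real.toNNReal_mono (hC _ ?_)
      rw [mem_closedBall_zero_iff]
      exact hx.le
    calc ‖h (ξ t)‖₊ ≤ γ₂ ‖u‖₊ + γ₂ ‖u‖₊ := (hol' _ _ hξ t).trans (by gcongr)
      _ ≤ _ := le_add_self.trans le_add_self

theorem isIOS_of_isOUAG (hf : LipschitzFstOnBounded f) (hFC : ForwardComplete f)
    (hh : Continuous h) (hf0 : f 0 0 = 0) (hag : IsOUAG (odeOutput f h)) :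
    IsIOS (odeOutput f h) := by
  have hs := hFC.isForwardCompleteSystem hf
  obtain ⟨γ, hγ, hag⟩ := hag
  have hag' : ∀ ε r s : ℝ≥0, 0 < ε → 0 < r → 0 < s → ∃ τ : ℝ≥0, ∀ R ξ,
      IsSolutionWithBound f R ξ → ‖ξ 0‖₊ < r → R < s → ∀ t : ℝ≥0, τ ≤ t →
      ‖h (ξ t)‖₊ ≤ ε + γ R := by
    intro ε r s hε hr hs
    obtain ⟨τ, hτ⟩ := hag ε r s hε hr hs
    refine ⟨τ, fun R ξ hξ h0 hR t ht => ?_⟩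
    obtain ⟨u, hu, hmap⟩ := hξ.exists_transitionMap_eq hf
    have h1 := hτ (ξ 0) u t h0 (hu.trans_lt hR) ht
    simp only [odeOutput, hmap] at h1
    refine h1.trans ?_
    gcongr
    exact hγ.1.2.2.monotone hu
  obtain ⟨σ, hσ, hσb⟩ := hs.exists_output_bound hh hf0 hγ hag'
  set ι := {p : ℝ≥0 × (ℝ → EuclideanSpace ℝ (Fin n)) × ℝ≥0 // IsSolutionWithBound f p.1 p.2.1}
    with hι
  have hexcess : ∀ R ξ, IsSolutionWithBound f R ξ → ∀ t : ℝ≥0,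
      ‖h (ξ t)‖₊ - (σ R + γ R) ≤ σ ‖ξ 0‖₊ := by
    intro R ξ hξ t
    rw [tsub_le_iff_right]
    refine (hσb R ξ hξ t).trans ?_
    rcases le_total ‖ξ 0‖₊ R with h1 | h1
    · rw [max_eq_right h1]; exact le_self_add.trans le_add_self
    · rw [max_eq_left h1]; exact le_self_add
  suffices H : ∃ β, IsClassKL β ∧ ∀ p : ι,
      ‖h (p.1.2.1 p.1.2.2)‖₊ - (σ p.1.1 + γ p.1.1) ≤ β ‖p.1.2.1 0‖₊ p.1.2.2 by
    obtain ⟨β, hβ, hβb⟩ := H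
    refine ⟨β, _, hβ, hσ.add hγ, fun x u t => ?_⟩
    obtain ⟨ξ, hξ, rfl, hmap⟩ := exists_isSolutionWithBound_eq_transitionMap hf hFC x u
    simp only [odeOutput, hmap]
    exact tsub_le_iff_right.1 (hβb ⟨(‖u‖₊, ξ, t), hξ⟩)
  refine exists_isClassKL_majorant ?_ ?_ ?_
  · intro r
    refine ⟨σ r, ?_⟩
    rintro ⟨⟨R, ξ, t⟩, hξ⟩ hp
    exact (hexcess R ξ hξ t).trans (hσ.1.2.2.monotone hp)
  · intro ε hε
    obtain ⟨δ, hδ, hσδ⟩ := hσ.1.exists_pos_le hε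
    refine ⟨δ, hδ, ?_⟩
    rintro ⟨⟨R, ξ, t⟩, hξ⟩ hp
    exact (hexcess R ξ hξ t).trans (hσδ _ hp)
  · intro ε r hε
    obtain ⟨τ, hτ⟩ := hag' ε (r + 1) (r + 1) hε (by positivity) (by positivity)
    refine ⟨τ, ?_⟩
    rintro ⟨⟨R, ξ, t⟩, hξ⟩ hp ht
    change ‖h (ξ t)‖₊ - (σ R + γ R) ≤ ε
    rw [tsub_le_iff_right]
    have hp' : ‖ξ 0‖₊ ≤ r := hp
    rcases le_total r R with hR | hR
    · -- a large input: the gain alone dominates the output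
      have h1 := hσb R ξ hξ t
      rw [max_eq_right (hp'.trans hR)] at h1
      exact h1.trans (le_self_add.trans le_add_self)
    · refine (hτ R ξ hξ (hp'.trans_lt (lt_add_one r)) (hR.trans_lt (lt_add_one r)) t ht).trans ?_
      gcongr
      exact le_add_self

end Main

theorem mainTheorem7 {n m : ℕ} {Y : Type*} [NormedAddCommGroup Y] [NormedSpace ℝ Y]
    (f : EuclideanSpace ℝ (Fin n) → EuclideanSpace ℝ (Fin m) → EuclideanSpace ℝ (Fin n))
    (h : EuclideanSpace ℝ (Fin n) → Y)
    (hf : LipschitzFstOnBounded f) (hh : Continuous h) (hFC : ForwardComplete f)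
    (h0 : h 0 = 0) :
    ((IsOLIM (odeOutput f h) ∧ IsOL (odeOutput f h)) ↔
      (IsOGUAG (odeOutput f h) ∧ IsOL (odeOutput f h))) ∧
    (f 0 0 = 0 → (IsOUAG (odeOutput f h) ↔ IsIOS (odeOutput f h))) :=
  ⟨⟨fun H => ⟨isOGUAG_of_isOLIM_of_isOL hf hFC hh H.1 H.2, H.2⟩,
    fun H => ⟨H.1.isOLIM, H.2⟩⟩,
    fun hf0 => ⟨isIOS_of_isOUAG hf hFC hh hf0, fun H => H.isOUAG⟩⟩
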